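/- An $\alpha/\beta$-staircase tableau of size $n$ is a filling of the Young diagram of shape $(n,n-1,\dots,1)$ (boxes $(i,j)$ with row $i\ge1$, column $j\ge 1$, $i+j\le n+1$, numbered from the north-west corner) in which each box is empty or contains $\alpha$ or $\beta$, such that every box with $i+j=n+1$ contains a symbol, all boxes in the same column and north of an $\alpha$ are empty, and all boxes in the same row and west of a $\beta$ are empty. The $k$-th diagonal consists of the boxes with $i+j=n-k+2$. For $\alpha,\beta\in[0,\infty)$, $(\alpha,\beta)\ne(0,0)$, let $\mathbb P_{n,\alpha,\beta}$ be the probability measure on these tableaux proportional to the weight $\alpha^{\#\alpha}\beta^{\#\beta}$; put $a=\alpha^{-1}$, $b=\beta^{-1}$ and $(x)_2=x(x-1)$. Let $\alpha_j$ be the event that the box of the $k$-th diagonal in column $j$ contains an $\alpha$. **Theorem.** Let $k\ge2$ and $r\ge1$ be fixed. If $1\le j_1<\dots<j_r\le n-k+1$ and $j_l\le j_{l+1}-k$ for all $l=1,\dots,r-1$, then $$\mathbb P_{n,\alpha,\beta}(\alpha_{j_1},\dots,\alpha_{j_r})=\prod_{l=1}^{r}\frac{b+j_{r-l+1}-2r+2l-1}{(n+a+b-2r+2l-1)_2}+O\!\left(\frac1{(n+a+b)^{r+1}}\right).$$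 If $1\le j_1<\dots<j_r\le n-k+1$ but the spacing condition fails, then $$\mathbb P_{n,\alpha,\beta}(\alpha_{j_1},\dots,\alpha_{j_r})=O\!\left(\frac1{(n+a+b)^{r}}\right).$$ The implied constants depend only on $k$ and $r$: the estimates are uniform in $n$, $j_1,\dots,j_r$ and $\alpha,\beta\in(0,\infty)$. If exactly one of $\alpha,\beta$ is $0$ (so that $a$ or $b$ is infinite), the probability is $0$. With the same constants, the estimates also hold for the limits of the probabilities (which exist) and of the products as $\alpha\to\infty$ with $\beta\in(0,\infty)$ fixed ($a=0$), as $\beta\to\infty$ with $\alpha\in(0,\infty)$ fixed ($b=0$), and as $\alpha=\beta\to\infty$ ($a=b=0$); the limit of the product is asserted to exist, and is used, when the spacing condition holds. -/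

import Mathlib

open Filter Topology

namespace StaircaseTableau

/-- The two symbols of an `α/β`-staircase tableau. -/
inductive Symb
  | alpha
  | beta
  deriving DecidableEq

instance : Fintype Symb where
  elems := {Symb.alpha, Symb.beta}
  complete := by intro x; cases x <;> simp

/-- A filling of an `n × n` array of boxes, each empty (`none`) or holding a symbol.
`T i c` is the box in row `i + 1` (from the north) and column `c + 1` (from the west). -/
abbrev Filling (n : ℕ) := Fin n → Fin n → Option Symb

/-- `α/β`-staircase tableaux of size `n`. The Young diagram of shape `(n, n-1, …, 1)` consists of
the boxes in row `i + 1` and column `c + 1` with `(i + 1) + (c + 1) ≤ n + 1`, and the first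
diagonal of those with equality. -/
structure IsStaircase {n : ℕ} (T : Filling n) : Prop where
  /-- boxes outside the diagram hold nothing -/
  outside : ∀ i c : Fin n, n < (i : ℕ) + c + 1 → T i c = none
  /-- every box on the first diagonal contains a symbol -/
  diagonal : ∀ i c : Fin n, (i : ℕ) + c + 1 = n → T i c ≠ none
  /-- all boxes in the same column and north of an `α` are empty -/
  north : ∀ i c : Fin n, T i c = some Symb.alpha → ∀ i' : Fin n, i' < i → T i' c = none
  /-- all boxes in the same row and west of a `β` are empty -/
  west : ∀ i c : Fin n, T i c = some Symb.beta → ∀ c' : Fin n, c' < c → T i c' = none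

open Classical in
/-- The finite set of `α/β`-staircase tableaux of size `n`. -/
noncomputable def tableaux (n : ℕ) : Finset (Filling n) :=
  Finset.univ.filter fun T => IsStaircase T

/-- The contribution of one box to the weight; an empty box contributes `1`. -/
def boxWeight (α β : ℝ) : Option Symb → ℝ
  | none => 1
  | some Symb.alpha => α
  | some Symb.beta => β

/-- The weight of a tableau: the product of all its symbols. -/
def weight {n : ℕ} (α β : ℝ) (T : Filling n) : ℝ :=
  ∏ i : Fin n, ∏ c : Fin n, boxWeight α β (T i c)

/-- The weight generating function `Z_n(α, β)`. -/
noncomputable def Z (n : ℕ) (α β : ℝ) : ℝ :=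
  ∑ T ∈ tableaux n, weight α β T

open Classical in
/-- The probability of the event `E` for a random tableau of size `n` chosen with probability
`weight / Z`. -/
noncomputable def prob (n : ℕ) (α β : ℝ) (E : Filling n → Prop) : ℝ :=
  ∑ T ∈ (tableaux n).filter E, weight α β T / Z n α β

/-- There is an `α` on the `k`-th diagonal in column `j`; the `k`-th diagonal consists of the boxes
in row `i + 1` and column `c + 1` with `(i + 1) + (c + 1) = n - k + 2`. -/
def AlphaAt {n : ℕ} (k j : ℕ) (T : Filling n) : Prop :=
  ∃ i c : Fin n, (c : ℕ) + 1 = j ∧ ((i : ℕ) + 1) + (c + 1) + k = n + 2 ∧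
    T i c = some Symb.alpha

/-- The probability that, for every `l`, there is an `α` on the `k`-th diagonal in
column `j l`. -/
noncomputable def alphaProb (n k : ℕ) (α β : ℝ) {r : ℕ} (j : Fin r → ℕ) : ℝ :=
  prob n α β fun T => ∀ l : Fin r, AlphaAt k (j l) T

/-- `1 ≤ j_1 < … < j_r ≤ n - k + 1`, where `j_{l+1}` is written `j l`. -/
def IsPositions (n k : ℕ) {r : ℕ} (j : Fin r → ℕ) : Prop :=
  StrictMono j ∧ ∀ l : Fin r, 1 ≤ j l ∧ j l + k ≤ n + 1

/-- Consecutive positions are at least `k` apart. -/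
def Spaced (k : ℕ) {r : ℕ} (j : Fin r → ℕ) : Prop :=
  ∀ l l' : Fin r, (l' : ℕ) = l + 1 → j l + k ≤ j l'

/-- The product over `l = 1, …, r` of
`(b + j_{r-l+1} - 2r + 2l - 1) / (n + a + b - 2r + 2l - 1)_2`, with `(x)_2 = x (x - 1)`.
The index `l` of the formula is `l + 1` here, and `j_{r-l+1}` is then `j l.rev`. -/
noncomputable def mainTerm (n : ℕ) (a b : ℝ) {r : ℕ} (j : Fin r → ℕ) : ℝ :=
  ∏ l : Fin r, (b + j l.rev - 2 * r + 2 * ((l : ℝ) + 1) - 1) /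
    (descPochhammer ℝ 2).eval ((n : ℝ) + a + b - 2 * r + 2 * ((l : ℝ) + 1) - 1)

/-- The estimates, with constant `C`, for the limiting law along parameters `α = x t`, `β = y t`,
`t → ∞`; here `a` and `b` are the limits of `1 / α` and `1 / β`. -/
def LimitEstimate (C : ℝ) (n k : ℕ) {r : ℕ} (j : Fin r → ℕ) (x y : ℝ → ℝ) (a b : ℝ) : Prop :=
  ∃ p : ℝ, Tendsto (fun t => alphaProb n k (x t) (y t) j) atTop (𝓝 p) ∧
    (Spaced k j → ∃ M : ℝ, Tendsto (fun t => mainTerm n (x t)⁻¹ (y t)⁻¹ j) atTop (𝓝 M) ∧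
      |p - M| ≤ C / ((n : ℝ) + a + b) ^ (r + 1)) ∧
    (¬ Spaced k j → |p| ≤ C / ((n : ℝ) + a + b) ^ r)

end StaircaseTableau

open StaircaseTableau

namespace StaircaseTableau

/-! A tableau of size n + 1 is a tableau T of size n with a new column to its west, whose bottom box
is alone in its row. A symbol may stand west of a row of T only if that row holds no β, so T acts on
the new column only through its set of β-free rows. Mark these rows by x = βξ. Summing over the new
column turns size n + 1 with mark βξ into αβ(a + ξ) times size n with mark β(ξ + 1)
(`genFun_plain`). Iteration gives the total weight (αβ)^n u(u + 1)⋯(u + n - 1) with u = a + ξ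
(`genFun_empty`); the probabilities belong to ξ = b, where the mark is 1. After normalization, a
column without event replaces (n + 1, ξ) by (n, ξ + 1) and preserves N = a + ξ + n (`ratio_plain`).

With rows counted from 0, the box of row p on the k-th diagonal lies in the column added in passing
from size p + k - 1 to p + k. An α there empties the boxes to its north, leaves only empty boxes and
β's to its south, and needs row p to be β-free so far. The first box of row p is then an α, with an
empty column above it. At size p + k this yields the exact factor ξ / ((N - 1)(N - 2)) times a
normalized sum over tableaux with row p free of β (`ratio_event`). The k - 2 columns in between obey
a two-term recurrence (`splitRatio_succ`), whose second term is smaller by a factor 1/N. Dropping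
that term leaves the probability of the remaining events at size p, with N lowered by 2. Spacing
keeps other events out of these columns, so induction on the number of events gives the product
(`splitRatio_estimate`, `ratio_estimate`).

Without spacing the waiting periods overlap, and an upper bound suffices: every row of an event
costs a factor 1/N at its birth, while the columns added during waiting periods lose only bounded
factors, and there are boundedly many of them (`aliveGen_le`).

All constants are uniform because the estimates see the parameters only through N and bounded
quotients. For infinite parameters, n being fixed, the probability and the product are bounded
rational functions of the growing parameter; they converge, and the estimates pass to the limit
(`limitEstimate_of_estimate`). -/

/-! ### Sums over a single column -/

/-- The sum over all fillings of `m` boxes of a column that have nothing north of an `α`,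
where symbol `o` in row `i` has weight `y i o`. -/
def colSum (y : ℕ → Option Symb → ℝ) : ℕ → ℝ
  | 0 => 1
  | m + 1 => (y m none + y m (some Symb.beta)) * colSum y m
      + y m (some Symb.alpha) * ∏ i ∈ Finset.range m, y i none

/-- Nothing stands north of an `α` in the column `v`. -/
def ColRule {m : ℕ} (v : Fin m → Option Symb) : Prop :=
  ∀ i, v i = some Symb.alpha → ∀ i', i' < i → v i' = none

theorem colRule_snoc {m : ℕ} (v : Fin m → Option Symb) (o : Option Symb) :
    ColRule (Fin.snoc (α := fun _ => Option Symb) v o) ↔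
      ColRule v ∧ (o = some Symb.alpha → v = fun _ => none) := by
  constructor
  · intro h
    refine ⟨fun i hi i' hii => ?_, fun ho => funext fun i => ?_⟩
    · have := h i.castSucc (by simpa using hi) i'.castSucc (by simpa using hii)
      simpa using this
    · have := h (Fin.last m) (by simpa using ho) i.castSucc (Fin.castSucc_lt_last i)
      simpa using this
  · rintro ⟨h1, h2⟩ i
    refine Fin.lastCases ?_ (fun i => ?_) i
    · intro ho i'
      refine Fin.lastCases ?_ (fun i' => ?_) i'
      · intro h; exact absurd h (lt_irrefl _)
      · intro _
        simp only [Fin.snoc_last] at ho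
        simp [h2 ho]
    · intro hi i'
      refine Fin.lastCases ?_ (fun i' => ?_) i'
      · intro h; exact absurd h (not_lt.mpr (Fin.le_last _))
      · intro hlt
        simp only [Fin.snoc_castSucc] at hi ⊢
        exact h1 i hi i' (by simpa using hlt)

theorem sum_symb (f : Option Symb → ℝ) :
    ∑ o, f o = f none + (f (some Symb.alpha) + f (some Symb.beta)) := by
  rw [Fintype.sum_option]
  congr 1
  have : (Finset.univ : Finset Symb) = {Symb.alpha, Symb.beta} := rfl
  rw [this, Finset.sum_pair (by decide)]

-- Peel off the bottom box: empty or β, it leaves the boxes above it unaffected; α, it forces all of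
-- them to be empty.
open Classical in
theorem sum_columns (y : ℕ → Option Symb → ℝ) (m : ℕ) :
    ∑ v : Fin m → Option Symb, (if ColRule v then ∏ i : Fin m, y i (v i) else 0) = colSum y m := by
  induction m with
  | zero =>
    rw [Fintype.sum_unique, if_pos (show ColRule _ from fun i => i.elim0)]
    simp [colSum]
  | succ m ih =>
    rw [← (Fin.snocEquiv fun _ => Option Symb).sum_comp, Fintype.sum_prod_type, sum_symb]
    have key : ∀ o : Option Symb, ∀ v : Fin m → Option Symb,
        (if ColRule ((Fin.snocEquiv fun _ => Option Symb) (o, v)) then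
          ∏ i : Fin (m + 1), y i ((Fin.snocEquiv fun _ => Option Symb) (o, v) i) else 0)
        = y m o * (if o = some Symb.alpha → v = fun _ => none then
            (if ColRule v then ∏ i : Fin m, y i (v i) else 0) else 0) := by
      intro o v
      have h1 : (Fin.snocEquiv fun _ => Option Symb) (o, v)
        = Fin.snoc (α := fun _ => Option Symb) v o := rfl
      rw [h1, Fin.prod_univ_castSucc]
      simp only [Fin.snoc_castSucc, Fin.snoc_last, Fin.val_castSucc, Fin.val_last, colRule_snoc]
      by_cases h2 : ColRule v <;> by_cases h3 : (o = some Symb.alpha → v = fun _ => none) <;>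
        simp [h2, h3, mul_comm]
    simp only [key, ← Finset.mul_sum]
    have hα : ∑ v : Fin m → Option Symb, (if v = fun _ => none then
        (if ColRule v then ∏ i : Fin m, y i (v i) else 0) else 0)
        = ∏ i ∈ Finset.range m, y i none := by
      rw [Finset.sum_ite_eq' Finset.univ (fun _ => none), if_pos (Finset.mem_univ _),
        if_pos (show ColRule _ from fun i hi => by simp at hi), Finset.prod_range]
    simp only [reduceCtorEq, Option.some.injEq, false_imp_iff, true_imp_iff, if_true, ih,
      hα, colSum]
    ring

/-! ### Building tableaux by adding columns to the west -/

/-- Row `i` holds no `β`. -/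
def RowFree {n : ℕ} (T : Filling n) (i : ℕ) : Prop :=
  ∀ r c : Fin n, (r : ℕ) = i → T r c ≠ some Symb.beta

/-- The filling of size `n + 1` with first column `v` and `T` to its east. -/
def glue {n : ℕ} (v : Fin (n + 1) → Option Symb) (T : Filling n) : Filling (n + 1) :=
  fun i c => Fin.cases (v i) (fun c' => Fin.lastCases none (fun i' => T i' c') i) c

@[simp] theorem glue_zero {n : ℕ} (v : Fin (n + 1) → Option Symb) (T : Filling n)
    (i : Fin (n + 1)) : glue v T i 0 = v i := rfl

@[simp] theorem glue_castSucc_succ {n : ℕ} (v : Fin (n + 1) → Option Symb) (T : Filling n)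
    (i c : Fin n) : glue v T i.castSucc c.succ = T i c := by simp [glue]

@[simp] theorem glue_last_succ {n : ℕ} (v : Fin (n + 1) → Option Symb) (T : Filling n)
    (c : Fin n) : glue v T (Fin.last n) c.succ = none := by simp [glue]

/-- The conditions for `v` to be the first column of a tableau with `T` to its east. -/
def ValidCol {n : ℕ} (T : Filling n) (v : Fin (n + 1) → Option Symb) : Prop :=
  ColRule v ∧ v (Fin.last n) ≠ none ∧ ∀ i, v i ≠ none → RowFree T i

/-- The rule for columns does not mix `v` with `T`. The rule for rows does so only through a β of
`T`, which forbids any symbol of `v` in its row. -/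
theorem isStaircase_glue {n : ℕ} (v : Fin (n + 1) → Option Symb) (T : Filling n) :
    IsStaircase (glue v T) ↔ IsStaircase T ∧ ValidCol T v := by
  constructor
  · intro h
    refine ⟨⟨fun i c hic => ?_, fun i c hic => ?_, fun i c hic i' hi' => ?_,
      fun i c hic c' hc' => ?_⟩, fun i hi i' hi' => ?_, ?_, fun i hi r c hr hT => ?_⟩
    · have := h.outside i.castSucc c.succ (by simp; omega)
      simpa using this
    · have := h.diagonal i.castSucc c.succ (by simp; omega)
      simpa using this
    · have := h.north i.castSucc c.succ (by simpa using hic) i'.castSucc (by simpa using hi')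
      simpa using this
    · have := h.west i.castSucc c.succ (by simpa using hic) c'.succ (by simpa using hc')
      simpa using this
    · exact h.north i 0 (by simpa using hi) i' hi'
    · exact h.diagonal (Fin.last n) 0 (by simp)
    · have hi' : i = r.castSucc := Fin.ext (by simp [hr])
      subst hi'
      have := h.west r.castSucc c.succ (by simpa using hT) 0 (Fin.succ_pos c)
      exact hi (by simpa using this)
  · rintro ⟨h, hv, hl, hf⟩
    refine ⟨fun i c => ?_, fun i c => ?_, fun i c => ?_, fun i c => ?_⟩
    · refine Fin.cases ?_ (fun c => ?_) c
      · intro hic; have := i.2; simp at hic; omega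
      · refine Fin.lastCases ?_ (fun i => ?_) i
        · simp
        · intro hic
          simp at hic ⊢
          exact h.outside i c (by omega)
    · refine Fin.cases ?_ (fun c => ?_) c
      · intro hic
        have : i = Fin.last n := Fin.ext (by simp at hic ⊢; omega)
        rw [this]; simpa using hl
      · refine Fin.lastCases ?_ (fun i => ?_) i
        · intro hic; simp at hic
        · intro hic
          simp at hic ⊢
          exact h.diagonal i c (by omega)
    · refine Fin.cases ?_ (fun c => ?_) c
      · intro hic i' hi'
        exact hv i (by simpa using hic) i' hi'
      · refine Fin.lastCases ?_ (fun i => ?_) i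
        · simp
        · intro hic i'
          refine Fin.lastCases ?_ (fun i' => ?_) i'
          · simp
          · intro hi'
            simp at hic hi' ⊢
            exact h.north i c hic i' hi'
    · refine Fin.cases ?_ (fun c => ?_) c
      · intro _ c' hc'; exact absurd hc' (by simp)
      · refine Fin.lastCases ?_ (fun i => ?_) i
        · simp
        · intro hic c'
          refine Fin.cases ?_ (fun c' => ?_) c'
          · intro _
            by_contra hne
            exact hf i.castSucc (by simpa using hne) i c (by simp) (by simpa using hic)
          · intro hc'
            simp at hic hc' ⊢
            exact h.west i c hic c' hc'

/-- The filling left when the first column and the last row are removed. -/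
def tailFilling {n : ℕ} (T : Filling (n + 1)) : Filling n := fun i c => T i.castSucc c.succ

theorem glue_tailFilling {n : ℕ} (T : Filling (n + 1)) (h : IsStaircase T) :
    glue (fun i => T i 0) (tailFilling T) = T := by
  funext i c
  refine Fin.cases ?_ (fun c => ?_) c
  · simp
  · refine Fin.lastCases ?_ (fun i => ?_) i
    · rw [glue_last_succ, h.outside _ _ (by simp)]
    · simp [tailFilling]

theorem weight_glue {n : ℕ} (α β : ℝ) (v : Fin (n + 1) → Option Symb) (T : Filling n) :
    weight α β (glue v T) = weight α β T * ∏ i, boxWeight α β (v i) := by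
  unfold weight
  simp only [Fin.prod_univ_succ (fun c => boxWeight α β (glue v T _ c)), glue_zero,
    Finset.prod_mul_distrib]
  rw [mul_comm, Fin.prod_univ_castSucc]
  simp [boxWeight]

theorem rowFree_glue {n : ℕ} (v : Fin (n + 1) → Option Symb) (T : Filling n) (i : Fin (n + 1)) :
    RowFree (glue v T) i ↔ RowFree T i ∧ v i ≠ some Symb.beta := by
  constructor
  · intro h
    refine ⟨fun r c hr => ?_, ?_⟩
    · have := h r.castSucc c.succ (by simpa using hr)
      simpa using this
    · exact h i 0 rfl
  · rintro ⟨h1, h2⟩ r c hr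
    have hr' : r = i := Fin.ext hr
    subst hr'
    refine Fin.cases ?_ (fun c => ?_) c
    · simpa using h2
    · revert h1
      refine Fin.lastCases ?_ (fun i => ?_) r
      · simp
      · intro h1
        have := h1 i c (by simp)
        simpa using this

open Classical in
theorem sum_tableaux_succ {n : ℕ} (f : Filling (n + 1) → ℝ) :
    ∑ T ∈ tableaux (n + 1), f T
      = ∑ T ∈ tableaux n, ∑ v : Fin (n + 1) → Option Symb,
          if ValidCol T v then f (glue v T) else 0 := by
  simp only [← Finset.sum_filter]
  rw [Finset.sum_sigma']
  symm
  refine Finset.sum_bij' (fun p _ => glue p.2 p.1) (fun T _ => ⟨tailFilling T, fun i => T i 0⟩)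
    ?_ ?_ ?_ ?_ ?_
  · rintro ⟨T, v⟩ h
    simp only [Finset.mem_sigma, tableaux, Finset.mem_filter, Finset.mem_univ, true_and] at h ⊢
    exact (isStaircase_glue v T).2 h
  · intro T h
    simp only [Finset.mem_sigma, tableaux, Finset.mem_filter, Finset.mem_univ, true_and] at h ⊢
    exact (isStaircase_glue _ _).1 (by rwa [glue_tailFilling T h])
  · rintro ⟨T, v⟩ h
    have : tailFilling (glue v T) = T := by
      funext i c
      simp [tailFilling]
    simp [this]
  · intro T h
    simp only [tableaux, Finset.mem_filter, Finset.mem_univ, true_and] at h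
    exact glue_tailFilling T h
  · rintro ⟨T, v⟩ h; rfl

/-! ### Generating functions with prescribed events -/

/-- In every row of `I`, the box on the `k`-th diagonal, if there is one, contains an `α`. -/
def Events {n : ℕ} (k : ℕ) (I : Finset ℕ) (T : Filling n) : Prop :=
  ∀ r c : Fin n, (r : ℕ) ∈ I → (r : ℕ) + c + k = n → T r c = some Symb.alpha

theorem events_glue {n k : ℕ} (hk : 1 ≤ k) (I : Finset ℕ) (v : Fin (n + 1) → Option Symb)
    (T : Filling n) : Events k I (glue v T) ↔
      Events k I T ∧ ∀ i : Fin (n + 1), (i : ℕ) ∈ I → (i : ℕ) + k = n + 1 →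
        v i = some Symb.alpha := by
  constructor
  · intro h
    refine ⟨fun r c hr hrc => ?_, fun i hi hik => ?_⟩
    · have := h r.castSucc c.succ (by simpa using hr) (by simp; omega)
      simpa using this
    · have := h i 0 hi (by simpa using hik)
      simpa using this
  · rintro ⟨h1, h2⟩ r c
    refine Fin.cases ?_ (fun c => ?_) c
    · intro hr hrc
      exact h2 r hr (by simpa using hrc)
    · refine Fin.lastCases ?_ (fun r => ?_) r
      · intro _ h; simp at h; omega
      · intro hr hrc
        simp only [glue_castSucc_succ]
        exact h1 r c (by simpa using hr) (by simp at hrc; omega)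

open Classical in
/-- The product of the marks of the rows: `X i` for a row without `β`, `Y i` otherwise. -/
noncomputable def rowMark {n : ℕ} (T : Filling n) (X Y : ℕ → ℝ) (i : ℕ) : ℝ :=
  if RowFree T i then X i else Y i

open Classical in
/-- The weight generating function of the tableaux with an `α` in the rows of `I` on the `k`-th
diagonal, rows without `β` being marked by `X` and the others by `Y`. -/
noncomputable def genFun (α β : ℝ) (k : ℕ) (I : Finset ℕ) (n : ℕ) (X Y : ℕ → ℝ) : ℝ :=
  ∑ T ∈ (tableaux n).filter (Events k I),
    weight α β T * ∏ i ∈ Finset.range n, rowMark T X Y i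

open Classical in
/-- The weight of symbol `o` in row `i` of a new first column to the west of `T`. -/
noncomputable def boxFactor (α β : ℝ) (k : ℕ) (I : Finset ℕ) {n : ℕ} (T : Filling n)
    (X Y : ℕ → ℝ) (i : ℕ) (o : Option Symb) : ℝ :=
  if (i ∈ I → i + k = n + 1 → o = some Symb.alpha) ∧ (i = n → o ≠ none) ∧
      (o ≠ none → RowFree T i) then
    boxWeight α β o * (if RowFree T i ∧ o ≠ some Symb.beta then X i else Y i) else 0

-- The conditions on the new column other than `ColRule` concern one box at a time, so they are
-- absorbed into the box weights, and `sum_columns` applies.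
open Classical in
theorem genFun_succ {α β : ℝ} {k : ℕ} (hk : 1 ≤ k) (I : Finset ℕ) (n : ℕ) (X Y : ℕ → ℝ) :
    genFun α β k I (n + 1) X Y = ∑ T ∈ (tableaux n).filter (Events k I),
      weight α β T * colSum (boxFactor α β k I T X Y) (n + 1) := by
  unfold genFun
  rw [Finset.sum_filter, sum_tableaux_succ, Finset.sum_filter]
  refine Finset.sum_congr rfl fun T _ => ?_
  rw [← sum_columns]
  by_cases hE : Events k I T
  · rw [if_pos hE, Finset.mul_sum]
    refine Finset.sum_congr rfl fun v _ => ?_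
    unfold boxFactor
    rw [Finset.prod_ite_zero, events_glue hk]
    by_cases hv : ValidCol T v
    · rw [if_pos hv, if_pos hv.1]
      by_cases he : ∀ i : Fin (n + 1), (i : ℕ) ∈ I → (i : ℕ) + k = n + 1 → v i = some Symb.alpha
      · rw [if_pos ⟨hE, he⟩, if_pos, weight_glue, Finset.prod_mul_distrib, mul_assoc,
          Finset.prod_range]
        · congr 2
          refine Finset.prod_congr rfl fun i _ => ?_
          simp only [rowMark, rowFree_glue]
        · intro i _
          refine ⟨he i, fun hi => ?_, hv.2.2 i⟩
          have : i = Fin.last n := Fin.ext hi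
          rw [this]; exact hv.2.1
      · rw [if_neg (fun h => he h.2), if_neg, mul_zero]
        exact fun h => he fun i => (h i (Finset.mem_univ _)).1
    · rw [if_neg hv]
      by_cases hc : ColRule v
      · rw [if_pos hc, if_neg, mul_zero]
        exact fun h => hv ⟨hc, (h (Fin.last n) (Finset.mem_univ _)).2.1 rfl,
          fun i => (h i (Finset.mem_univ _)).2.2⟩
      · rw [if_neg hc, mul_zero]
  · rw [if_neg hE]
    refine Finset.sum_eq_zero fun v _ => ?_
    rw [if_neg (fun h => hE ((events_glue hk I v T).1 h).1), ite_self]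

theorem rowMark_of_free {n : ℕ} {T : Filling n} {X Y : ℕ → ℝ} {i : ℕ} (h : RowFree T i) :
    rowMark T X Y i = X i := if_pos h

theorem rowMark_of_not_free {n : ℕ} {T : Filling n} {X Y : ℕ → ℝ} {i : ℕ} (h : ¬ RowFree T i) :
    rowMark T X Y i = Y i := if_neg h

theorem rowFree_of_le {n : ℕ} (T : Filling n) {i : ℕ} (h : n ≤ i) : RowFree T i :=
  fun r _ hr => absurd r.2 (by omega)

/-! ### Column sums above a fixed tableau -/

section BoxFactor

variable {α β : ℝ} {k : ℕ} {I : Finset ℕ} {n : ℕ} {T : Filling n} {X Y : ℕ → ℝ} {i : ℕ}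

theorem boxFactor_none (h : i ∈ I → i + k ≠ n + 1) (hi : i < n) :
    boxFactor α β k I T X Y i none = rowMark T X Y i := by
  have h1 : (i ∈ I → i + k = n + 1 → (none : Option Symb) = some Symb.alpha) :=
    fun a b => absurd b (h a)
  rw [boxFactor, if_pos ⟨h1, fun e => absurd e hi.ne, by simp⟩]
  by_cases hf : RowFree T i
  · rw [if_pos ⟨hf, nofun⟩, rowMark_of_free hf, boxWeight, one_mul]
  · rw [if_neg (fun h => hf h.1), rowMark_of_not_free hf, boxWeight, one_mul]

theorem boxFactor_alpha_of_free (h : RowFree T i) :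
    boxFactor α β k I T X Y i (some Symb.alpha) = α * X i := by
  simp [boxFactor, boxWeight, h]

theorem boxFactor_beta_of_free (h : i ∈ I → i + k ≠ n + 1) (hf : RowFree T i) :
    boxFactor α β k I T X Y i (some Symb.beta) = β * Y i := by
  have h1 : (i ∈ I → i + k = n + 1 → (some Symb.beta : Option Symb) = some Symb.alpha) :=
    fun a b => absurd b (h a)
  rw [boxFactor, if_pos ⟨h1, by simp, fun _ => hf⟩]
  simp [boxWeight]

theorem boxFactor_of_not_free {s : Symb} (h : ¬ RowFree T i) :
    boxFactor α β k I T X Y i (some s) = 0 := by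
  simp [boxFactor, h]

theorem boxFactor_bottom : boxFactor α β k I T X Y n none = 0 := by
  simp [boxFactor]

theorem boxFactor_event {o : Option Symb} (hi : i ∈ I) (hik : i + k = n + 1)
    (ho : o ≠ some Symb.alpha) : boxFactor α β k I T X Y i o = 0 := by
  simp [boxFactor, hi, hik, ho]

theorem prod_boxFactor_none {m : ℕ} (h : ∀ i ∈ I, i < m → i + k ≠ n + 1) (hm : m ≤ n) :
    ∏ i ∈ Finset.range m, boxFactor α β k I T X Y i none
      = ∏ i ∈ Finset.range m, rowMark T X Y i :=
  Finset.prod_congr rfl fun i hi => by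
    rw [Finset.mem_range] at hi
    exact boxFactor_none (fun h1 => h i h1 hi) (by omega)

theorem colSum_succ_of_free (h : ∀ i ∈ I, i < n → i + k ≠ n + 1) {m : ℕ} (hm : m < n)
    (hf : RowFree T m) :
    colSum (boxFactor α β k I T X Y) (m + 1)
      = (X m + β * Y m) * colSum (boxFactor α β k I T X Y) m
        + α * X m * ∏ i ∈ Finset.range m, rowMark T X Y i := by
  rw [colSum, boxFactor_none (fun h1 => h m h1 hm) hm, rowMark_of_free hf,
    boxFactor_beta_of_free (fun h1 => h m h1 hm) hf, boxFactor_alpha_of_free hf,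
    prod_boxFactor_none (fun i h1 h2 => h i h1 (by omega)) hm.le]

theorem colSum_succ_of_not_free (h : ∀ i ∈ I, i < n → i + k ≠ n + 1) {m : ℕ} (hm : m < n)
    (hf : ¬ RowFree T m) :
    colSum (boxFactor α β k I T X Y) (m + 1)
      = Y m * colSum (boxFactor α β k I T X Y) m := by
  rw [colSum, boxFactor_none (fun h1 => h m h1 hm) hm, rowMark_of_not_free hf,
    boxFactor_of_not_free hf, boxFactor_of_not_free hf]
  ring

/-- The column sum when the new column meets no event. -/
theorem colSum_bottom (hk : 2 ≤ k) (h : ∀ i ∈ I, i < n → i + k ≠ n + 1) :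
    colSum (boxFactor α β k I T X Y) (n + 1)
      = β * Y n * colSum (boxFactor α β k I T X Y) n
        + α * X n * ∏ i ∈ Finset.range n, rowMark T X Y i := by
  rw [colSum, boxFactor_bottom, boxFactor_alpha_of_free (rowFree_of_le T le_rfl),
    boxFactor_beta_of_free (fun _ => by omega) (rowFree_of_le T le_rfl),
    prod_boxFactor_none h le_rfl]
  ring

/-- The column sum when the new column has to hold an `α` in row `e`. -/
theorem colSum_event (hk : 2 ≤ k) {e : ℕ} (he : e ∈ I) (hek : e + k = n + 1) :
    colSum (boxFactor α β k I T X Y) (n + 1)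
      = α * β * X e * Y n * ∏ i ∈ Finset.range n,
        rowMark T (fun i => if i < e then X i else if i = e then 1 else X i + β * Y i)
          (fun i => if i = e then 0 else Y i) i := by
  set X' : ℕ → ℝ := fun i => if i < e then X i else if i = e then 1 else X i + β * Y i
  set Y' : ℕ → ℝ := fun i => if i = e then 0 else Y i
  -- An α south of row `e` would empty the event box, so the α term of the recursion vanishes below
  -- row `e`.
  have hpi : ∀ m, e < m → ∏ i ∈ Finset.range m, boxFactor α β k I T X Y i none = 0 := by
    intro m hm
    exact Finset.prod_eq_zero (Finset.mem_range.2 hm) (boxFactor_event he hek (by simp))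
  have key : ∀ m, e + 1 ≤ m → m ≤ n → colSum (boxFactor α β k I T X Y) m
      = α * X e * ∏ i ∈ Finset.range m, rowMark T X' Y' i := by
    intro m hm
    induction m, hm using Nat.le_induction with
    | base =>
      intro _
      rw [colSum, boxFactor_event he hek (by simp), boxFactor_event he hek (by simp),
        prod_boxFactor_none (fun i h1 h2 => by omega) (by omega), Finset.prod_range_succ]
      have h1 : ∏ i ∈ Finset.range e, rowMark T X Y i = ∏ i ∈ Finset.range e, rowMark T X' Y' i := by
        refine Finset.prod_congr rfl fun i hi => ?_
        rw [Finset.mem_range] at hi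
        simp [rowMark, X', Y', hi, hi.ne]
      rw [h1]
      by_cases hf : RowFree T e
      · rw [boxFactor_alpha_of_free hf, rowMark_of_free hf]
        simp [X']
      · rw [boxFactor_of_not_free hf, rowMark_of_not_free hf]
        simp [Y']
    | succ m hm ih =>
      intro hmn
      have hm' : m ∈ I → m + k ≠ n + 1 := fun _ => by omega
      rw [colSum, hpi m (by omega), ih (by omega), boxFactor_none hm' (by omega),
        Finset.prod_range_succ]
      have hX : X' m = X m + β * Y m := by
        simp only [X']; rw [if_neg (by omega), if_neg (by omega)]
      have hY : Y' m = Y m := by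
        simp only [Y']; rw [if_neg (by omega)]
      by_cases hf : RowFree T m
      · rw [boxFactor_beta_of_free hm' hf, rowMark_of_free hf, rowMark_of_free hf, hX]
        ring
      · rw [boxFactor_of_not_free hf, rowMark_of_not_free hf, rowMark_of_not_free hf, hY]
        ring
  rw [colSum, boxFactor_bottom, hpi n (by omega), key n (by omega) le_rfl,
    boxFactor_beta_of_free (fun _ => by omega) (rowFree_of_le T le_rfl)]
  ring

end BoxFactor

/-! ### Recurrences for the generating functions -/

section GenFun

variable {α β : ℝ} {k : ℕ} {I : Finset ℕ} {n : ℕ} {X Y : ℕ → ℝ}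

theorem genFun_congr {X' Y' : ℕ → ℝ} (hX : ∀ i < n, X i = X' i) (hY : ∀ i < n, Y i = Y' i) :
    genFun α β k I n X Y = genFun α β k I n X' Y' := by
  unfold genFun
  refine Finset.sum_congr rfl fun T _ => ?_
  congr 1
  refine Finset.prod_congr rfl fun i hi => ?_
  rw [Finset.mem_range] at hi
  simp [rowMark, hX i hi, hY i hi]

theorem weight_nonneg (hα : 0 ≤ α) (hβ : 0 ≤ β) (T : Filling n) : 0 ≤ weight α β T := by
  refine Finset.prod_nonneg fun i _ => Finset.prod_nonneg fun c _ => ?_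
  rcases T i c with _ | _ | _ <;> simp [boxWeight, hα, hβ]

theorem rowMark_nonneg (hX : ∀ i, 0 ≤ X i) (hY : ∀ i, 0 ≤ Y i) (T : Filling n) (i : ℕ) :
    0 ≤ rowMark T X Y i := by
  unfold rowMark; split_ifs
  exacts [hX i, hY i]

theorem genFun_nonneg (hα : 0 ≤ α) (hβ : 0 ≤ β) (hX : ∀ i, 0 ≤ X i) (hY : ∀ i, 0 ≤ Y i) :
    0 ≤ genFun α β k I n X Y :=
  Finset.sum_nonneg fun T _ => mul_nonneg (weight_nonneg hα hβ T)
    (Finset.prod_nonneg fun i _ => rowMark_nonneg hX hY T i)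

theorem prod_rowMark_le {X' : ℕ → ℝ} (hX : ∀ i, 0 ≤ X i) (hY : ∀ i, 0 ≤ Y i) {m : ℕ}
    (h : ∀ i < m, X i ≤ X' i) (T : Filling n) :
    ∏ i ∈ Finset.range m, rowMark T X Y i ≤ ∏ i ∈ Finset.range m, rowMark T X' Y i := by
  refine Finset.prod_le_prod (fun i _ => rowMark_nonneg hX hY T i) fun i hi => ?_
  unfold rowMark
  split_ifs
  exacts [h i (Finset.mem_range.1 hi), le_rfl]

theorem genFun_mono {X' : ℕ → ℝ} (hα : 0 ≤ α) (hβ : 0 ≤ β) (hX : ∀ i, 0 ≤ X i)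
    (hY : ∀ i, 0 ≤ Y i) (h : ∀ i < n, X i ≤ X' i) :
    genFun α β k I n X Y ≤ genFun α β k I n X' Y :=
  Finset.sum_le_sum fun T _ => mul_le_mul_of_nonneg_left (prod_rowMark_le hX hY h T)
    (weight_nonneg hα hβ T)

open Classical in
theorem genFun_zero : genFun α β k I 0 X Y = 1 := by
  have hT : ∀ T : Filling 0, T ∈ (tableaux 0).filter (Events k I) := by
    intro T
    simp only [tableaux, Finset.mem_filter, Finset.mem_univ, true_and]
    exact ⟨⟨fun i => i.elim0, fun i => i.elim0, fun i => i.elim0, fun i => i.elim0⟩,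
      fun i => i.elim0⟩
  unfold genFun
  rw [Finset.eq_univ_of_forall hT, Fintype.sum_unique]
  simp [weight]

/-- A new column whose bottom row may not hold a `β`. -/
theorem genFun_birth (hk : 2 ≤ k) (h : ∀ i ∈ I, i < n → i + k ≠ n + 1) (hY : Y n = 0) :
    genFun α β k I (n + 1) X Y = α * X n * genFun α β k I n X Y := by
  rw [genFun_succ (by omega), genFun, Finset.mul_sum]
  refine Finset.sum_congr rfl fun T _ => ?_
  rw [colSum_bottom hk h, hY]
  ring

/-- North of the event the new column is empty; south of it a free row either stays empty or
receives a β, whence the mark `X i + β * Y i`. The marks 1 and 0 force row `e` to be free of β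
before the event. -/
theorem genFun_event (hk : 2 ≤ k) {e : ℕ} (he : e ∈ I) (hek : e + k = n + 1) :
    genFun α β k I (n + 1) X Y = α * β * X e * Y n * genFun α β k I n
      (fun i => if i < e then X i else if i = e then 1 else X i + β * Y i)
      (fun i => if i = e then 0 else Y i) := by
  rw [genFun_succ (by omega), genFun, Finset.mul_sum]
  refine Finset.sum_congr rfl fun T _ => ?_
  rw [colSum_event hk he hek]
  ring

/-- The column sum and the product of marks satisfy a triangular linear recursion from row to row,
and this combination of them is an eigenvector: a free row multiplies it by x + β, any other row by
1. It is also what the two choices for the bottom box produce in `colSum_bottom`. -/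
theorem colSum_ordinary (h : ∀ i ∈ I, i < n → i + k ≠ n + 1) {x : ℝ} (T : Filling n) {m : ℕ}
    (hm : m ≤ n) (hX : ∀ i < m, X i = x) (hY : ∀ i < m, Y i = 1) :
    β * colSum (boxFactor α β k I T X Y) m + α * x * ∏ i ∈ Finset.range m, rowMark T X Y i
      = (β + α * x) * ∏ i ∈ Finset.range m, rowMark T (fun i => X i + β) Y i := by
  induction m with
  | zero => simp [colSum]
  | succ m ih =>
    have ih := ih (by omega) (fun i hi => hX i (by omega)) (fun i hi => hY i (by omega))
    rw [Finset.prod_range_succ, Finset.prod_range_succ, ← mul_assoc, ← mul_assoc, ← ih]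
    by_cases hf : RowFree T m
    · rw [colSum_succ_of_free h (by omega) hf, rowMark_of_free hf, rowMark_of_free hf,
        hX m (by omega), hY m (by omega)]
      ring
    · rw [colSum_succ_of_not_free h (by omega) hf, rowMark_of_not_free hf,
        rowMark_of_not_free hf, hY m (by omega)]
      ring

/-- A new column that meets no event, all rows being unrestricted. -/
theorem genFun_plain (hk : 2 ≤ k) (h : ∀ i ∈ I, i < n → i + k ≠ n + 1) (x : ℝ) :
    genFun α β k I (n + 1) (fun _ => x) (fun _ => 1)
      = (β + α * x) * genFun α β k I n (fun _ => x + β) (fun _ => 1) := by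
  rw [genFun_succ (by omega), genFun, Finset.mul_sum]
  refine Finset.sum_congr rfl fun T _ => ?_
  rw [colSum_bottom hk h, mul_one, colSum_ordinary h T le_rfl (fun _ _ => rfl) (fun _ _ => rfl)]
  ring

/-- The marks when row `ρ` may not hold a `β`, the rows to its north are marked by `x` and those
to its south by `y`. -/
def splitMark (ρ : ℕ) (x y : ℝ) (i : ℕ) : ℝ := if i < ρ then x else if i = ρ then 1 else y

/-- A new column that meets no event, row `ρ` not being allowed to hold a `β`. -/
theorem genFun_split (hk : 2 ≤ k) (h : ∀ i ∈ I, i < n → i + k ≠ n + 1) {ρ : ℕ} (hρ : ρ < n)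
    (x y : ℝ) :
    genFun α β k I (n + 1) (splitMark ρ x y) (fun i => if i = ρ then 0 else 1)
      = (β + α * x) * genFun α β k I n (splitMark ρ (x + β) (y + β)) (fun i => if i = ρ then 0 else 1)
        + α * (y + β - x) *
          genFun α β k I n (splitMark ρ x (y + β)) (fun i => if i = ρ then 0 else 1) := by
  rw [genFun_succ (by omega), genFun, genFun, Finset.mul_sum, Finset.mul_sum,
    ← Finset.sum_add_distrib]
  refine Finset.sum_congr rfl fun T _ => ?_
  set Y : ℕ → ℝ := fun i => if i = ρ then 0 else 1
  set X := splitMark ρ x y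
  have key : ∀ m, ρ + 1 ≤ m → m ≤ n →
      β * colSum (boxFactor α β k I T X Y) m + α * y * ∏ i ∈ Finset.range m, rowMark T X Y i
      = (β + α * x) * ∏ i ∈ Finset.range m, rowMark T (splitMark ρ (x + β) (y + β)) Y i
        + α * (y + β - x) * ∏ i ∈ Finset.range m, rowMark T (splitMark ρ x (y + β)) Y i := by
    intro m hm
    induction m, hm using Nat.le_induction with
    | base =>
      intro hmn
      have h0 := colSum_ordinary (α := α) (β := β) (X := X) (Y := Y) h (x := x) T (m := ρ)
        (by omega) (fun i hi => by simp [X, splitMark, hi]) (fun i hi => by simp [Y, hi.ne])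
      have h1 : ∏ i ∈ Finset.range ρ, rowMark T (fun i => X i + β) Y i
          = ∏ i ∈ Finset.range ρ, rowMark T (splitMark ρ (x + β) (y + β)) Y i :=
        Finset.prod_congr rfl fun i hi => by
          rw [Finset.mem_range] at hi
          simp [rowMark, X, splitMark, hi]
      have h2 : ∏ i ∈ Finset.range ρ, rowMark T X Y i
          = ∏ i ∈ Finset.range ρ, rowMark T (splitMark ρ x (y + β)) Y i :=
        Finset.prod_congr rfl fun i hi => by
          rw [Finset.mem_range] at hi
          simp [rowMark, X, splitMark, hi]
      simp only [Finset.prod_range_succ]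
      have e0 : Y ρ = 0 := by simp [Y]
      have e1 : X ρ = 1 := by simp [X, splitMark]
      have e2 : ∀ u v, splitMark ρ u v ρ = 1 := by simp [splitMark]
      -- Row ρ, with marks 1 and 0, adds α times the product of marks to the column sum. With the
      -- change of the coefficient αx to αy south of ρ, this gives the second term α(y + β - x).
      by_cases hf : RowFree T ρ
      · rw [colSum_succ_of_free h (by omega) hf, rowMark_of_free hf, rowMark_of_free hf,
          rowMark_of_free hf, e0, e1, e2, e2, ← h1, ← h2]
        linear_combination h0
      · rw [colSum_succ_of_not_free h (by omega) hf, rowMark_of_not_free hf,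
          rowMark_of_not_free hf, rowMark_of_not_free hf, e0]
        ring
    | succ m hm ih =>
      intro hmn
      have ih := ih (by omega)
      simp only [Finset.prod_range_succ]
      have e0 : Y m = 1 := by simp only [Y]; rw [if_neg (by omega)]
      have e2 : ∀ u v, splitMark ρ u v m = v := by
        intro u v; rw [splitMark, if_neg (by omega), if_neg (by omega)]
      have e3 : X m = y := e2 x y
      by_cases hf : RowFree T m
      · rw [colSum_succ_of_free h (by omega) hf, rowMark_of_free hf, rowMark_of_free hf,
          rowMark_of_free hf, e0, e3, e2, e2]
        linear_combination (y + β) * ih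
      · rw [colSum_succ_of_not_free h (by omega) hf, rowMark_of_not_free hf,
          rowMark_of_not_free hf, rowMark_of_not_free hf, e0]
        linear_combination ih
  have e0 : Y n = 1 := by simp only [Y]; rw [if_neg (by omega)]
  have e1 : X n = y := by simp only [X]; rw [splitMark, if_neg (by omega), if_neg (by omega)]
  rw [colSum_bottom hk h, e0, e1, mul_one, key n (by omega) le_rfl]
  ring

/-! ### Inequalities for rows awaiting their events -/

/-- Row `i` is restricted to hold no `β` until its event takes place. -/
def Alive (k : ℕ) (I : Finset ℕ) (n i : ℕ) : Prop := i ∈ I ∧ i < n ∧ n < i + k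

open Classical in
/-- The generating function with all rows awaiting their event restricted to hold no `β`. -/
noncomputable def aliveGen (α β : ℝ) (k : ℕ) (I : Finset ℕ) (n : ℕ) (x : ℝ) : ℝ :=
  genFun α β k I n (fun i => if Alive k I n i then 1 else x) (fun i => if Alive k I n i then 0 else 1)

open Classical in
/-- The number of rows awaiting their event. -/
noncomputable def aliveCount (k : ℕ) (I : Finset ℕ) (n : ℕ) : ℕ :=
  ((Finset.range n).filter (Alive k I n)).card

-- As in `colSum_ordinary`, but each free row in `A` adds αβ times the product of marks to the
-- combination, which is at most αβ times the product with x raised to x + β.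
open Classical in
theorem colSum_le (hα : 0 ≤ α) (hβ : 0 ≤ β) (h : ∀ i ∈ I, i < n → i + k ≠ n + 1) {x : ℝ}
    (hx : 0 ≤ x) (T : Filling n) (A : ℕ → Prop) {m : ℕ} (hm : m ≤ n) :
    β * colSum (boxFactor α β k I T (fun i => if A i then 1 else x) (fun i => if A i then 0 else 1)) m
        + α * x * ∏ i ∈ Finset.range m,
          rowMark T (fun i => if A i then 1 else x) (fun i => if A i then 0 else 1) i
      ≤ (β + α * x + α * β * ((Finset.range m).filter A).card) * ∏ i ∈ Finset.range m,
          rowMark T (fun i => if A i then 1 else x + β) (fun i => if A i then 0 else 1) i := by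
  have hY : ∀ i, (0 : ℝ) ≤ if A i then 0 else 1 := fun i => by split_ifs <;> norm_num
  have hX : ∀ i, (0 : ℝ) ≤ if A i then 1 else x := fun i => by split_ifs <;> linarith
  have hX' : ∀ i, (0 : ℝ) ≤ if A i then 1 else x + β := fun i => by split_ifs <;> linarith
  induction m with
  | zero => simp [colSum]
  | succ m ih =>
    have ih := ih (by omega)
    have hle := prod_rowMark_le (X' := fun i => if A i then 1 else x + β) hX hY (m := m)
      (fun i _ => by split_ifs <;> linarith) T
    have hnn := Finset.prod_nonneg (s := Finset.range m) fun i _ => rowMark_nonneg hX' hY T i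
    have hab : 0 ≤ α * β := mul_nonneg hα hβ
    rw [Finset.prod_range_succ, Finset.prod_range_succ,
      show (Finset.range (m + 1)).filter A = if A m then insert m ((Finset.range m).filter A)
        else (Finset.range m).filter A by rw [Finset.range_add_one, Finset.filter_insert]]
    set P := ∏ i ∈ Finset.range m,
          rowMark T (fun i => if A i then 1 else x) (fun i => if A i then 0 else 1) i
    set P' := ∏ i ∈ Finset.range m,
          rowMark T (fun i => if A i then 1 else x + β) (fun i => if A i then 0 else 1) i
    by_cases hA : A m
    · rw [if_pos hA, Finset.card_insert_of_notMem (by simp)]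
      by_cases hf : RowFree T m
      · rw [colSum_succ_of_free h (by omega) hf, rowMark_of_free hf, rowMark_of_free hf,
          if_pos hA, if_pos hA, if_pos hA]
        push_cast
        nlinarith [mul_le_mul_of_nonneg_left hle hab]
      · rw [colSum_succ_of_not_free h (by omega) hf, rowMark_of_not_free hf,
          rowMark_of_not_free hf, if_pos hA]
        simp
    · rw [if_neg hA]
      by_cases hf : RowFree T m
      · rw [colSum_succ_of_free h (by omega) hf, rowMark_of_free hf, rowMark_of_free hf,
          if_neg hA, if_neg hA, if_neg hA]
        linarith [mul_le_mul_of_nonneg_left ih (add_nonneg hx hβ)]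
      · rw [colSum_succ_of_not_free h (by omega) hf, rowMark_of_not_free hf,
          rowMark_of_not_free hf, if_neg hA]
        linarith

theorem alive_succ_iff (h : ∀ i ∈ I, i < n → i + k ≠ n + 1) {i : ℕ} (hi : i < n) :
    Alive k I (n + 1) i ↔ Alive k I n i := by
  constructor
  · rintro ⟨h1, h2, h3⟩; exact ⟨h1, hi, by omega⟩
  · rintro ⟨h1, h2, h3⟩
    have := h i h1 hi
    exact ⟨h1, by omega, by omega⟩

open Classical in
theorem aliveGen_birth (hk : 2 ≤ k) (h : ∀ i ∈ I, i < n → i + k ≠ n + 1) (hn : n ∈ I) (x : ℝ) :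
    aliveGen α β k I (n + 1) x = α * aliveGen α β k I n x := by
  have hA : Alive k I (n + 1) n := ⟨hn, by omega, by omega⟩
  unfold aliveGen
  rw [genFun_birth hk h (by simp [hA]), if_pos hA, mul_one]
  refine congrArg (α * ·) (genFun_congr (fun i hi => ?_) (fun i hi => ?_))
  all_goals exact if_congr (alive_succ_iff h hi) rfl rfl

/-- The bottom box of the new column may not be β, and an α there would empty the event box. -/
theorem aliveGen_birth_event (hk : 2 ≤ k) {e : ℕ} (he : e ∈ I) (hek : e + k = n + 1) (hn : n ∈ I)
    (x : ℝ) : aliveGen α β k I (n + 1) x = 0 := by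
  have hA : Alive k I (n + 1) n := ⟨hn, by omega, by omega⟩
  unfold aliveGen
  rw [genFun_event hk he hek]
  simp [hA]

theorem alive_succ_iff_of_event {e : ℕ} (hek : e + k = n + 1) {i : ℕ} (hi : i < n) :
    Alive k I (n + 1) i ↔ Alive k I n i ∧ i ≠ e := by
  constructor
  · rintro ⟨h1, h2, h3⟩; exact ⟨⟨h1, hi, by omega⟩, by omega⟩
  · rintro ⟨⟨h1, h2, h3⟩, h4⟩
    exact ⟨h1, by omega, by omega⟩

open Classical in
theorem aliveGen_event (hα : 0 ≤ α) (hβ : 0 ≤ β) (hk : 2 ≤ k) {e : ℕ} (he : e ∈ I)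
    (hek : e + k = n + 1) (hn : n ∉ I) {x : ℝ} (hx : 0 ≤ x) :
    aliveGen α β k I (n + 1) x ≤ α * β * x * aliveGen α β k I n (x + β) := by
  have hA : ¬ Alive k I (n + 1) n := fun h => hn h.1
  have hA' : ¬ Alive k I (n + 1) e := fun h => by have := h.2.2; omega
  have hAe : Alive k I n e := ⟨he, by omega, by omega⟩
  unfold aliveGen
  rw [genFun_event hk he hek, if_neg hA, if_neg hA', mul_one]
  refine mul_le_mul_of_nonneg_left ?_ (by positivity)
  rw [genFun_congr (Y := fun i => if i = e then 0 else if Alive k I (n + 1) i then 0 else 1)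
    (Y' := fun i => if Alive k I n i then 0 else 1) (fun i _ => rfl)]
  · refine genFun_mono hα hβ (fun i => ?_) (fun i => ?_) (fun i hi => ?_)
    · split_ifs <;> linarith
    · split_ifs <;> norm_num
    -- Only the rows north of `e` lose something: their exact mark is x, and it is raised to x + β.
    · rcases lt_trichotomy i e with hie | rfl | hie
      · have h1 : ¬ Alive k I (n + 1) i := fun h => by have := h.2.2; omega
        have h2 : ¬ Alive k I n i := fun h => by have := h.2.2; omega
        rw [if_pos hie, if_neg h1, if_neg h2]
        linarith
      · simp [hAe]
      · rw [if_neg (by omega), if_neg (by omega)]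
        have : Alive k I (n + 1) i ↔ Alive k I n i := by
          rw [alive_succ_iff_of_event hek hi]; simp [hie.ne']
        by_cases h1 : Alive k I n i
        · simp [this, h1]
        · simp [this, h1]
  · intro i hi
    by_cases hie : i = e
    · subst hie; simp [hAe]
    · simp [hie, alive_succ_iff_of_event hek hi]

theorem aliveGen_plain (hα : 0 ≤ α) (hβ : 0 ≤ β) (hk : 2 ≤ k)
    (h : ∀ i ∈ I, i < n → i + k ≠ n + 1) (hn : n ∉ I) {x : ℝ} (hx : 0 ≤ x) :
    aliveGen α β k I (n + 1) x
      ≤ (β + α * x + α * β * aliveCount k I n) * aliveGen α β k I n (x + β) := by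
  classical
  have hA : ¬ Alive k I (n + 1) n := fun h => hn h.1
  unfold aliveGen
  rw [genFun_succ (by omega), genFun, Finset.mul_sum]
  refine Finset.sum_le_sum fun T _ => ?_
  rw [colSum_bottom hk h, if_neg hA, if_neg hA, mul_one, mul_left_comm]
  refine mul_le_mul_of_nonneg_left ?_ (weight_nonneg hα hβ T)
  refine (colSum_le hα hβ h hx T (Alive k I (n + 1)) le_rfl).trans (le_of_eq ?_)
  congr 1
  · congr 3
    unfold aliveCount
    congr 1
    ext i
    simp only [Finset.mem_filter, Finset.mem_range]
    exact and_congr_right fun hi => alive_succ_iff h hi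
  · refine Finset.prod_congr rfl fun i hi => ?_
    rw [Finset.mem_range] at hi
    simp only [rowMark, alive_succ_iff h hi]

theorem aliveCount_birth (hk : 2 ≤ k) (h : ∀ i ∈ I, i < n → i + k ≠ n + 1) (hn : n ∈ I) :
    aliveCount k I (n + 1) = aliveCount k I n + 1 := by
  classical
  unfold aliveCount
  rw [← Finset.card_insert_of_notMem (a := n) (by simp)]
  congr 1
  ext i
  simp only [Finset.mem_filter, Finset.mem_range, Finset.mem_insert]
  rcases lt_trichotomy i n with hi | rfl | hi
  · have := hi.ne
    simp only [hi, alive_succ_iff h hi, this, Nat.lt_succ_of_lt hi]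
    tauto
  · simp only [Nat.lt_succ_self, true_and, true_or, iff_true]
    exact ⟨hn, by omega, by omega⟩
  · constructor <;> intro h' <;> omega

theorem aliveCount_plain (h : ∀ i ∈ I, i < n → i + k ≠ n + 1) (hn : n ∉ I) :
    aliveCount k I (n + 1) = aliveCount k I n := by
  classical
  unfold aliveCount
  congr 1
  ext i
  simp only [Finset.mem_filter, Finset.mem_range]
  rcases lt_trichotomy i n with hi | rfl | hi
  · simp only [hi, alive_succ_iff h hi, Nat.lt_succ_of_lt hi]
  · constructor
    · rintro ⟨_, h'⟩; exact absurd h'.1 hn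
    · rintro ⟨h', _⟩; omega
  · constructor <;> intro h' <;> omega

theorem aliveCount_event (hk : 2 ≤ k) {e : ℕ} (he : e ∈ I) (hek : e + k = n + 1) (hn : n ∉ I) :
    aliveCount k I n = aliveCount k I (n + 1) + 1 := by
  classical
  unfold aliveCount
  rw [← Finset.card_insert_of_notMem (a := e)]
  · congr 1
    ext i
    simp only [Finset.mem_filter, Finset.mem_range, Finset.mem_insert]
    rcases lt_trichotomy i n with hi | rfl | hi
    · simp only [hi, alive_succ_iff_of_event hek hi, Nat.lt_succ_of_lt hi, true_and]
      by_cases hie : i = e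
      · subst hie
        simp only [true_or, iff_true]
        exact ⟨he, by omega, by omega⟩
      · simp [hie]
    · constructor
      · rintro ⟨h', _⟩; omega
      · rintro (h' | ⟨_, h'⟩)
        · omega
        · exact absurd h'.1 hn
    · constructor <;> intro h' <;> omega
  · simp only [Finset.mem_filter]
    rintro ⟨_, h'⟩
    have := h'.2.2; omega

end GenFun

/-! ### The total weight, and the upper bound without spacing -/

/-- The total weight `(αβ)ⁿ u (u + 1) ⋯ (u + n - 1)`; for `u = 1 / α + 1 / β` it is `Z n α β`. -/
noncomputable def totalWeight (α β : ℝ) (n : ℕ) (u : ℝ) : ℝ :=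
  (α * β) ^ n * ∏ i ∈ Finset.range n, (u + i)

section

variable {α β : ℝ} {k : ℕ} {I : Finset ℕ} {n : ℕ} {u : ℝ}

theorem totalWeight_zero : totalWeight α β 0 u = 1 := by simp [totalWeight]

theorem totalWeight_succ :
    totalWeight α β (n + 1) u = α * β * (u + n) * totalWeight α β n u := by
  unfold totalWeight
  rw [Finset.prod_range_succ]; ring

theorem totalWeight_succ' :
    totalWeight α β (n + 1) u = α * β * u * totalWeight α β n (u + 1) := by
  unfold totalWeight
  rw [Finset.prod_range_succ']
  have : ∀ i : ℕ, u + ((i + 1 : ℕ) : ℝ) = u + 1 + i := fun i => by push_cast; ring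
  simp only [this]
  push_cast; ring

theorem totalWeight_pos (hα : 0 < α) (hβ : 0 < β) (hu : 0 < u) : 0 < totalWeight α β n u := by
  unfold totalWeight
  exact mul_pos (by positivity) (Finset.prod_pos fun i _ => by positivity)

theorem totalWeight_nonneg (hα : 0 < α) (hβ : 0 < β) (hu : 0 ≤ u) : 0 ≤ totalWeight α β n u := by
  unfold totalWeight
  exact mul_nonneg (by positivity) (Finset.prod_nonneg fun i _ => by positivity)

theorem aliveGen_nonneg (hα : 0 ≤ α) (hβ : 0 ≤ β) {x : ℝ} (hx : 0 ≤ x) :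
    0 ≤ aliveGen α β k I n x :=
  genFun_nonneg hα hβ (fun i => by split_ifs <;> linarith) (fun i => by split_ifs <;> norm_num)

theorem aliveCount_le : aliveCount k I n ≤ I.card := by
  classical
  exact Finset.card_le_card fun i hi => (Finset.mem_filter.1 hi).2.1

/-- A row waits during fewer than k sizes, so this bounds the total loss in `aliveGen_le`. -/
theorem sum_aliveCount_le : ∑ m ∈ Finset.range n, aliveCount k I (m + 1) ≤ k * I.card := by
  classical
  have h1 : ∀ m, aliveCount k I m ≤ ∑ i ∈ I, if Alive k I m i then 1 else 0 := by
    intro m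
    rw [← Finset.card_filter]
    refine Finset.card_le_card fun i hi => ?_
    rw [Finset.mem_filter] at hi ⊢
    exact ⟨hi.2.1, hi.2⟩
  refine (Finset.sum_le_sum fun m _ => h1 (m + 1)).trans ?_
  rw [Finset.sum_comm, mul_comm, ← smul_eq_mul]
  refine Finset.sum_le_card_nsmul _ _ _ fun i _ => ?_
  rw [← Finset.card_filter]
  calc _ ≤ (Finset.Ico i (i + k)).card := Finset.card_le_card fun m hm => by
        rw [Finset.mem_filter] at hm
        rw [Finset.mem_Ico]
        have := hm.2.2
        omega
    _ = k := by simp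

/-- The number of rows of `I` among the first `n`. -/
def bornCount (I : Finset ℕ) (n : ℕ) : ℕ := ((Finset.range n).filter (· ∈ I)).card

theorem bornCount_succ_of_mem (h : n ∈ I) : bornCount I (n + 1) = bornCount I n + 1 := by
  unfold bornCount
  rw [Finset.range_add_one, Finset.filter_insert, if_pos h, Finset.card_insert_of_notMem (by simp)]

theorem bornCount_succ_of_notMem (h : n ∉ I) : bornCount I (n + 1) = bornCount I n := by
  unfold bornCount
  rw [Finset.range_add_one, Finset.filter_insert, if_neg h]

theorem bornCount_le : bornCount I n ≤ I.card :=
  Finset.card_le_card fun _ hi => (Finset.mem_filter.1 hi).2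

/-- Up to a bounded factor, each row of `I` costs a factor `1 / (a + ξ + n)`. -/
theorem aliveGen_le {a : ℝ} (ha : 0 < a) (haα : α * a = 1) (hβ : 0 < β) (hk : 2 ≤ k)
    (n : ℕ) : ∀ ξ : ℝ, 0 ≤ ξ → (0 < aliveCount k I n → 1 ≤ a + ξ) →
    aliveGen α β k I n (β * ξ) * β ^ aliveCount k I n * (a + ξ + n) ^ bornCount I n
      ≤ (2 ^ I.card) ^ (∑ m ∈ Finset.range n, aliveCount k I (m + 1))
        * totalWeight α β n (a + ξ) := by
  have hα : 0 < α := by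
    by_contra h
    nlinarith [mul_nonneg (neg_nonneg.2 (not_lt.1 h)) ha.le]
  have hαβ : 0 < α * β := mul_pos hα hβ
  induction n with
  | zero =>
    intro ξ _ _
    simp [aliveGen, genFun_zero, totalWeight_zero, aliveCount, bornCount]
  | succ n ih =>
    intro ξ hξ hal
    have hx : 0 ≤ β * ξ := by positivity
    have hG0 : 0 ≤ aliveGen α β k I n (β * ξ) := aliveGen_nonneg hα.le hβ.le hx
    have hshift : β * ξ + β = β * (ξ + 1) := by ring
    have hx1 : 0 ≤ β * (ξ + 1) := by positivity
    have hG1 : 0 ≤ aliveGen α β k I n (β * (ξ + 1)) := aliveGen_nonneg hα.le hβ.le hx1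
    have hN : a + ξ + ((n + 1 : ℕ) : ℝ) = a + (ξ + 1) + n := by push_cast; ring
    by_cases hev : ∃ e ∈ I, e + k = n + 1
    · obtain ⟨e, he, hek⟩ := hev
      by_cases hn : n ∈ I
      · rw [aliveGen_birth_event hk he hek hn]
        have := totalWeight_nonneg (n := n + 1) hα hβ (add_nonneg ha.le hξ)
        simp only [zero_mul]
        positivity
      · have hs := aliveCount_event hk he hek hn
        have ih := ih (ξ + 1) (by linarith) (fun _ => by linarith)
        have h1 := aliveGen_event hα.le hβ.le hk he hek hn hx
        rw [hshift] at h1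
        rw [bornCount_succ_of_notMem hn, hN, totalWeight_succ', Finset.sum_range_succ]
        rw [hs, pow_succ] at ih
        have hD := totalWeight_nonneg (n := n) hα hβ (u := a + (ξ + 1)) (by linarith)
        calc _ ≤ (α * β * (β * ξ) * aliveGen α β k I n (β * (ξ + 1)))
              * β ^ aliveCount k I (n + 1) * (a + (ξ + 1) + n) ^ bornCount I n := by
              gcongr
          -- The extra β of the event pays for the row that stops waiting, which is why the bound
          -- carries the power of β.
          _ = α * β * ξ * (aliveGen α β k I n (β * (ξ + 1)) * (β ^ aliveCount k I (n + 1) * β) *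
              (a + (ξ + 1) + n) ^ bornCount I n) := by ring
          _ ≤ α * β * (a + ξ) * ((2 ^ I.card) ^ (∑ m ∈ Finset.range n, aliveCount k I (m + 1))
              * totalWeight α β n (a + (ξ + 1))) := by
              gcongr; linarith
          _ ≤ (2 ^ I.card) ^ (∑ m ∈ Finset.range n, aliveCount k I (m + 1)
              + aliveCount k I (n + 1)) * (α * β * (a + ξ) * totalWeight α β n (a + (ξ + 1))) := by
              have hp : (1 : ℝ) ≤ (2 ^ I.card) ^ aliveCount k I (n + 1) :=
                one_le_pow₀ (one_le_pow₀ (by norm_num))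
              exact (le_mul_of_one_le_left (by positivity) hp).trans
                (le_of_eq (by rw [pow_add]; ring))
          _ = _ := by rw [add_assoc a ξ 1]
    · have hev' : ∀ i ∈ I, i < n → i + k ≠ n + 1 := fun i hi _ h => hev ⟨i, hi, h⟩
      by_cases hn : n ∈ I
      · have hs := aliveCount_birth hk hev' hn
        have hu : 1 ≤ a + ξ := hal (by omega)
        have ih := ih ξ hξ (fun _ => hu)
        have hD := totalWeight_nonneg (n := n) hα hβ (u := a + ξ) (by linarith)
        have hb : bornCount I n + 1 ≤ I.card := by
          rw [← bornCount_succ_of_mem hn]; exact bornCount_le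
        rw [aliveGen_birth hk hev' hn, hs, bornCount_succ_of_mem hn, totalWeight_succ,
          Finset.sum_range_succ, hs]
        have hN2 : a + ξ + ((n + 1 : ℕ) : ℝ) ≤ 2 * (a + ξ + n) := by
          push_cast; linarith [Nat.cast_nonneg (α := ℝ) n]
        have hN0 : 0 ≤ a + ξ + n := by positivity
        calc _ ≤ α * aliveGen α β k I n (β * ξ) * β ^ (aliveCount k I n + 1)
              * (2 * (a + ξ + n)) ^ (bornCount I n + 1) := by gcongr
          _ = 2 ^ (bornCount I n + 1) * (α * β * (a + ξ + n)) * (aliveGen α β k I n (β * ξ)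
              * β ^ aliveCount k I n * (a + ξ + n) ^ bornCount I n) := by rw [mul_pow]; ring
          _ ≤ 2 ^ I.card * (α * β * (a + ξ + n)) *
              ((2 ^ I.card) ^ (∑ m ∈ Finset.range n, aliveCount k I (m + 1))
                * totalWeight α β n (a + ξ)) := by
              gcongr
              norm_num
          _ ≤ (2 ^ I.card) ^ (aliveCount k I n + 1) * (α * β * (a + ξ + n)) *
              ((2 ^ I.card) ^ (∑ m ∈ Finset.range n, aliveCount k I (m + 1))
                * totalWeight α β n (a + ξ)) := by
              gcongr
              exact le_self_pow₀ (one_le_pow₀ (by norm_num)) (by omega)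
          _ = _ := by rw [pow_add _ (∑ m ∈ Finset.range n, aliveCount k I (m + 1))]; ring
      · have hs := aliveCount_plain hev' hn
        have ih := ih (ξ + 1) (by linarith) (fun _ => by linarith)
        have h1 := aliveGen_plain hα.le hβ.le hk hev' hn hx
        have h2 : β + α * (β * ξ) + α * β * aliveCount k I n
            = α * β * (a + ξ + aliveCount k I n) := by linear_combination (-β) * haα
        rw [hshift, h2] at h1
        -- Without waiting rows this is an equality, however small a + ξ is. Otherwise a + ξ ≥ 1
        -- bounds the relative loss by 1 + `aliveCount`.
        have hfac : a + ξ + aliveCount k I n ≤ (2 ^ I.card) ^ aliveCount k I n * (a + ξ) := by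
          rcases Nat.eq_zero_or_pos (aliveCount k I n) with h0 | h0
          · rw [h0]; simp
          · have hu : 1 ≤ a + ξ := hal (by omega)
            have h3 : (1 : ℝ) + aliveCount k I n ≤ 2 ^ I.card := by
              have h4 : aliveCount k I n + 1 ≤ 2 ^ I.card :=
                lt_of_le_of_lt aliveCount_le Nat.lt_two_pow_self
              have : ((aliveCount k I n + 1 : ℕ) : ℝ) ≤ ((2 ^ I.card : ℕ) : ℝ) := by
                exact_mod_cast h4
              push_cast at this; linarith
            have h5 : (2 : ℝ) ^ I.card ≤ (2 ^ I.card) ^ aliveCount k I n :=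
              le_self_pow₀ (one_le_pow₀ (by norm_num)) (by omega)
            nlinarith [Nat.cast_nonneg (α := ℝ) (aliveCount k I n)]
        have hD := totalWeight_nonneg (n := n) hα hβ (u := a + (ξ + 1)) (by linarith)
        rw [bornCount_succ_of_notMem hn, hN, totalWeight_succ', Finset.sum_range_succ, hs]
        calc _ ≤ (α * β * (a + ξ + aliveCount k I n) * aliveGen α β k I n (β * (ξ + 1)))
              * β ^ aliveCount k I n * (a + (ξ + 1) + n) ^ bornCount I n := by gcongr
          _ = α * β * (a + ξ + aliveCount k I n) * (aliveGen α β k I n (β * (ξ + 1))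
              * β ^ aliveCount k I n * (a + (ξ + 1) + n) ^ bornCount I n) := by ring
          _ ≤ α * β * ((2 ^ I.card) ^ aliveCount k I n * (a + ξ)) *
              ((2 ^ I.card) ^ (∑ m ∈ Finset.range n, aliveCount k I (m + 1))
              * totalWeight α β n (a + (ξ + 1))) := by gcongr
          _ = _ := by rw [pow_add, ← add_assoc a ξ 1]; ring

theorem genFun_empty {a : ℝ} (haα : α * a = 1) (hk : 2 ≤ k) (n : ℕ) : ∀ ξ : ℝ,
    genFun α β k ∅ n (fun _ => β * ξ) (fun _ => 1) = totalWeight α β n (a + ξ) := by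
  induction n with
  | zero => intro ξ; rw [genFun_zero, totalWeight_zero]
  | succ n ih =>
    intro ξ
    rw [genFun_plain hk (by simp), show β * ξ + β = β * (ξ + 1) by ring, ih, totalWeight_succ',
      add_assoc]
    linear_combination (-β * totalWeight α β n (a + (ξ + 1))) * haα

end

/-! ### Normalized generating functions and their exact recursions -/

section

variable {α β a : ℝ} {k : ℕ} {I : Finset ℕ} {n : ℕ}

/-- The probability of the events, for the parameters `1 / a` and `1 / ξ`. -/
noncomputable def ratio (α β a : ℝ) (k : ℕ) (I : Finset ℕ) (n : ℕ) (ξ : ℝ) : ℝ :=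
  genFun α β k I n (fun _ => β * ξ) (fun _ => 1) / totalWeight α β n (a + ξ)

/-- The normalized generating function of the tableaux of size `p + 1 + m` whose row `p` holds
no `β`. -/
noncomputable def splitRatio (α β a : ℝ) (k : ℕ) (I : Finset ℕ) (p m : ℕ) (ξ : ℝ) (y : ℕ) : ℝ :=
  genFun α β k I (p + 1 + m) (splitMark p (β * ξ) (β * (ξ + y))) (fun i => if i = p then 0 else 1)
    / (α * totalWeight α β (p + m) (a + ξ))

open Classical in
theorem genFun_le_empty {X Y : ℕ → ℝ} (hα : 0 ≤ α) (hβ : 0 ≤ β) (hX : ∀ i, 0 ≤ X i)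
    (hY : ∀ i, 0 ≤ Y i) : genFun α β k I n X Y ≤ genFun α β k ∅ n X Y := by
  unfold genFun
  refine Finset.sum_le_sum_of_subset_of_nonneg (fun T hT => ?_) fun T _ _ =>
    mul_nonneg (weight_nonneg hα hβ T) (Finset.prod_nonneg fun i _ => rowMark_nonneg hX hY T i)
  rw [Finset.mem_filter] at hT ⊢
  exact ⟨hT.1, fun r c hr => by simp at hr⟩

theorem alpha_pos (ha : 0 < a) (haα : α * a = 1) : 0 < α :=
  pos_of_mul_pos_left (haα ▸ one_pos) ha.le

theorem ratio_nonneg (ha : 0 < a) (haα : α * a = 1) (hβ : 0 < β) {ξ : ℝ} (hξ : 0 ≤ ξ) :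
    0 ≤ ratio α β a k I n ξ :=
  div_nonneg (genFun_nonneg (alpha_pos ha haα).le hβ.le (fun _ => by positivity)
    (fun _ => by norm_num)) (totalWeight_nonneg (alpha_pos ha haα) hβ (by positivity))

theorem ratio_le_one (ha : 0 < a) (haα : α * a = 1) (hβ : 0 < β) (hk : 2 ≤ k) {ξ : ℝ}
    (hξ : 0 ≤ ξ) : ratio α β a k I n ξ ≤ 1 := by
  have hα := alpha_pos ha haα
  refine div_le_one_of_le₀ ?_ (totalWeight_nonneg hα hβ (by positivity))
  rw [← genFun_empty haα hk]
  exact genFun_le_empty hα.le hβ.le (fun _ => by positivity) (fun _ => by norm_num)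

theorem ratio_zero (ξ : ℝ) : ratio α β a k I 0 ξ = 1 := by
  rw [ratio, genFun_zero, totalWeight_zero, div_one]

theorem ratio_plain (ha : 0 < a) (haα : α * a = 1) (hβ : 0 < β) (hk : 2 ≤ k)
    (h : ∀ i ∈ I, i < n → i + k ≠ n + 1) {ξ : ℝ} (hξ : 0 ≤ ξ) :
    ratio α β a k I (n + 1) ξ = ratio α β a k I n (ξ + 1) := by
  have hα := alpha_pos ha haα
  have hD := totalWeight_pos (n := n) hα hβ (u := a + (ξ + 1)) (by positivity)
  have hu : 0 < a + ξ := by positivity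
  unfold ratio
  rw [genFun_plain hk h, totalWeight_succ', show β * ξ + β = β * (ξ + 1) by ring, add_assoc a ξ 1,
    show β + α * (β * ξ) = α * β * (a + ξ) by linear_combination (-β) * haα,
    mul_div_mul_left _ _ (by positivity)]

/-- Row `p` has just been born with an α, which contributes the factor α and otherwise leaves the
tableau of size `p` as it was. -/
theorem splitRatio_zero {p : ℕ} (hα : 0 < α) (hk : 2 ≤ k)
    (h : ∀ i ∈ I, i < p → i + k ≠ p + 1) (ξ : ℝ) (y : ℕ) :
    splitRatio α β a k I p 0 ξ y = ratio α β a k I p ξ := by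
  unfold splitRatio ratio
  rw [add_zero, add_zero, genFun_birth hk h (by simp), show splitMark p (β * ξ) (β * (ξ + y)) p = 1
    by simp [splitMark], mul_one, mul_div_mul_left _ _ hα.ne']
  congr 1
  refine genFun_congr (fun i hi => ?_) (fun i hi => ?_)
  · simp [splitMark, hi]
  · simp [hi.ne]

/-- `genFun_split` with both marks divided by β: x = βξ and y' = β(ξ + y), so y' + β - x = β(y + 1).
The first term keeps a + ξ + p + m fixed as in `ratio_plain`; the second gains its reciprocal. -/
theorem splitRatio_succ {p m : ℕ} (ha : 0 < a) (haα : α * a = 1) (hβ : 0 < β) (hk : 2 ≤ k)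
    (h : ∀ i ∈ I, i < p + 1 + m → i + k ≠ p + 1 + m + 1) {ξ : ℝ} (hξ : 0 ≤ ξ) (y : ℕ) :
    splitRatio α β a k I p (m + 1) ξ y = splitRatio α β a k I p m (ξ + 1) y
      + (y + 1) / (a + ξ + (p + m : ℕ)) * splitRatio α β a k I p m ξ (y + 1) := by
  have hα := alpha_pos ha haα
  have hD := totalWeight_pos (n := p + m) hα hβ (u := a + (ξ + 1)) (by positivity)
  have hD' := totalWeight_pos (n := p + m) hα hβ (u := a + ξ) (by positivity)
  have hu : 0 < a + ξ := by positivity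
  have hN : 0 < a + ξ + (p + m : ℕ) := by positivity
  unfold splitRatio
  rw [← add_assoc, genFun_split hk h (by omega), add_div]
  congr 1
  · rw [← add_assoc, totalWeight_succ', show β * ξ + β = β * (ξ + 1) by ring, add_assoc a ξ 1,
      show β + α * (β * ξ) = α * β * (a + ξ) by linear_combination (-β) * haα,
      show β * (ξ + y) + β = β * (ξ + 1 + y) by ring, mul_left_comm α,
      mul_div_mul_left _ _ (by positivity)]
  · rw [← add_assoc, totalWeight_succ, show β * (ξ + y) + β = β * (ξ + (y + 1 : ℕ)) by
      push_cast; ring]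
    push_cast at hN ⊢
    field_simp
    ring

/-- After the event the southern rows carry the mark β(ξ + 1), hence the last argument 1. The
denominator consists of the two factors by which the total weights of sizes p + k and p + k - 2
differ. -/
theorem ratio_event {p : ℕ} (ha : 0 < a) (haα : α * a = 1) (hβ : 0 < β) (hk : 2 ≤ k)
    (hp : p ∈ I) {ξ : ℝ} (hξ : 0 ≤ ξ) :
    ratio α β a k I (p + k) ξ = ξ / ((a + ξ + (p + k : ℕ) - 1) * (a + ξ + (p + k : ℕ) - 2))
      * splitRatio α β a k I p (k - 2) ξ 1 := by
  have hα := alpha_pos ha haα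
  obtain ⟨m, rfl⟩ : ∃ m, k = m + 2 := ⟨k - 2, by omega⟩
  have hD := totalWeight_pos (n := p + m) hα hβ (u := a + ξ) (by positivity)
  have hu : 0 < a + ξ := by positivity
  have hN : 0 < a + ξ + p + m := by positivity
  unfold ratio splitRatio
  rw [Nat.add_sub_cancel, show p + (m + 2) = p + 1 + m + 1 by omega,
    genFun_event hk hp (by omega), show p + 1 + m + 1 = p + m + 1 + 1 by omega, totalWeight_succ,
    totalWeight_succ]
  have hX : genFun α β (m + 2) I (p + 1 + m)
      (fun i => if i < p then β * ξ else if i = p then 1 else β * ξ + β * 1)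
      (fun i => if i = p then 0 else 1)
    = genFun α β (m + 2) I (p + 1 + m) (splitMark p (β * ξ) (β * (ξ + (1 : ℕ))))
      (fun i => if i = p then 0 else 1) := by
    refine genFun_congr (fun i _ => ?_) (fun i _ => rfl)
    simp only [splitMark]
    split_ifs
    · rfl
    · rfl
    · push_cast; ring
  rw [hX]
  have e1 : a + ξ + ((p + m + 1 + 1 : ℕ) : ℝ) - 1 = a + ξ + p + m + 1 := by push_cast; ring
  have e2 : a + ξ + ((p + m + 1 + 1 : ℕ) : ℝ) - 2 = a + ξ + p + m := by push_cast; ring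
  have e3 : a + ξ + ((p + m + 1 : ℕ) : ℝ) = a + ξ + p + m + 1 := by push_cast; ring
  have e4 : a + ξ + ((p + m : ℕ) : ℝ) = a + ξ + p + m := by push_cast; ring
  rw [e1, e2, e3, e4]
  have hN1 : 0 < a + ξ + p + m + 1 := by positivity
  field_simp

/-- The main term: row `i` contributes `(N - a - k - i) / ((N - 1) (N - 2))`, and `N` decreases
by `2` from one row to the next. -/
noncomputable def rowMain (a : ℝ) (k : ℕ) : List ℕ → ℝ → ℝ
  | [], _ => 1
  | i :: L, N => (N - a - k - i) / ((N - 1) * (N - 2)) * rowMain a k L (N - 2)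

/-- Each factor is at most 2/N for its own N, and replacing N by N - 2 costs at most 2 for each
later row. -/
theorem rowMain_bound (ha : 0 < a) (hk : 2 ≤ k) (L : List ℕ) :
    L.Pairwise (fun i i' => i' + k ≤ i) → ∀ N : ℝ, 0 ≤ N → (∀ i ∈ L, a + k + i ≤ N) →
    0 ≤ rowMain a k L N ∧ rowMain a k L N * N ^ L.length ≤ 2 ^ (L.length ^ 2) := by
  induction L with
  | nil => intro _ N _ _; simp [rowMain]
  | cons i L ih =>
    intro hL N _ hN
    rw [List.pairwise_cons] at hL
    have hi := hN i (by simp)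
    have hk' : (2 : ℝ) ≤ k := by exact_mod_cast hk
    have hi0 : (0 : ℝ) ≤ i := Nat.cast_nonneg i
    have hN2 : 0 < N - 2 := by linarith
    obtain ⟨h0, h1⟩ := ih hL.2 (N - 2) hN2.le (fun i' hi' => by
      have : ((i' + k : ℕ) : ℝ) ≤ i := by exact_mod_cast hL.1 i' hi'
      push_cast at this
      linarith)
    have hf0 : 0 ≤ (N - a - k - i) / ((N - 1) * (N - 2)) :=
      div_nonneg (by linarith) (mul_nonneg (by linarith) hN2.le)
    have hf1 : (N - a - k - i) / ((N - 1) * (N - 2)) * N ≤ 2 := by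
      rw [div_mul_eq_mul_div, div_le_iff₀ (mul_pos (by linarith) hN2)]
      nlinarith
    have hpow : rowMain a k L (N - 2) * N ^ L.length ≤ 2 ^ L.length * 2 ^ (L.length ^ 2) := by
      rcases L with _ | ⟨i', L⟩
      · simp [rowMain]
      · have : ((i' + k : ℕ) : ℝ) ≤ i := by exact_mod_cast hL.1 i' (by simp)
        push_cast at this
        have hi0' : (0 : ℝ) ≤ i' := Nat.cast_nonneg i'
        -- A later row i' gives i ≥ k, hence N ≥ 2k ≥ 4.
        have h2 : N ≤ 2 * (N - 2) := by linarith
        calc _ ≤ rowMain a k (i' :: L) (N - 2) * (2 * (N - 2)) ^ (i' :: L).length := by gcongr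
          _ = 2 ^ (i' :: L).length *
            (rowMain a k (i' :: L) (N - 2) * (N - 2) ^ (i' :: L).length) := by rw [mul_pow]; ring
          _ ≤ _ := by gcongr
    refine ⟨mul_nonneg hf0 h0, ?_⟩
    rw [rowMain, List.length_cons]
    calc _ = ((N - a - k - i) / ((N - 1) * (N - 2)) * N)
          * (rowMain a k L (N - 2) * N ^ L.length) := by rw [pow_succ]; ring
      _ ≤ 2 * (2 ^ L.length * 2 ^ (L.length ^ 2)) :=
          mul_le_mul hf1 hpow (by positivity) (by norm_num)
      _ = 2 ^ (1 + L.length + L.length ^ 2) := by rw [pow_add, pow_add]; ring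
      _ ≤ _ := pow_le_pow_right₀ (by norm_num) (by nlinarith)

end

/-! ### Asymptotics for well-spaced events -/

/-- The normalized generating function of the tableaux with row `p` free of `β` differs little
from that of the tableaux of size `p`. -/
theorem splitRatio_estimate {k t : ℕ} (hk : 2 ≤ k) {K : ℝ} (hK : 0 ≤ K) (m : ℕ) :
    ∀ y : ℕ, ∃ K', 0 ≤ K' ∧ ∀ α β a : ℝ, 0 < a → α * a = 1 → 0 < β →
      ∀ (I : Finset ℕ) (L : List ℕ) (p : ℕ), L.length = t → L.Pairwise (fun i i' => i' + k ≤ i) →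
      (∀ i ∈ L, i + k ≤ p) → (∀ i ∈ I, i < p + 1 + m → i + k ≤ p ∨ p + 1 + m < i + k) →
      (∀ ξ, 0 ≤ ξ → |ratio α β a k I p ξ - rowMain a k L (a + ξ + p)| * (a + ξ + p) ^ (t + 1) ≤ K) →
      ∀ ξ, 0 ≤ ξ → 1 ≤ a + ξ + p →
        |splitRatio α β a k I p m ξ y - rowMain a k L (a + ξ + p + m)|
          * (a + ξ + p + m) ^ (t + 1) ≤ K' := by
  induction m with
  | zero =>
    intro y
    refine ⟨K, hK, fun α β a ha haα hβ I L p hLt hLp hL hI hest ξ hξ _ => ?_⟩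
    rw [splitRatio_zero (alpha_pos ha haα) hk]
    · simpa using hest ξ hξ
    · intro i hi hip
      rcases hI i hi (by omega) with h | h <;> omega
  | succ m ih =>
    intro y
    obtain ⟨K₁, hK₁, h₁⟩ := ih y
    obtain ⟨K₂, hK₂, h₂⟩ := ih (y + 1)
    refine ⟨K₁ + (y + 1) * 2 ^ (t + 1) * (2 ^ (t ^ 2) + K₂), by positivity,
      fun α β a ha haα hβ I L p hLt hLp hL hI hest ξ hξ hξp => ?_⟩
    have hI' : ∀ i ∈ I, i < p + 1 + m → i + k ≤ p ∨ p + 1 + m < i + k := fun i hi him => by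
      rcases hI i hi (by omega) with h | h
      · exact Or.inl h
      · exact Or.inr (by omega)
    have e₁ := h₁ α β a ha haα hβ I L p hLt hLp hL hI' hest (ξ + 1) (by linarith) (by linarith)
    have e₂ := h₂ α β a ha haα hβ I L p hLt hLp hL hI' hest ξ hξ hξp
    rw [splitRatio_succ ha haα hβ hk (fun i hi him => by
      rcases hI i hi (by omega) with h | h <;> omega) hξ]
    have hm0 : (0 : ℝ) ≤ m := Nat.cast_nonneg m
    have hN1 : a + (ξ + 1) + p + m = a + ξ + p + (m + 1 : ℕ) := by push_cast; ring
    rw [hN1] at e₁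
    obtain ⟨N, hN⟩ : ∃ N, N = a + ξ + p + m := ⟨_, rfl⟩
    have hN1' : a + ξ + p + (m + 1 : ℕ) = N + 1 := by rw [hN]; push_cast; ring
    have hN2' : a + ξ + (p + m : ℕ) = N := by rw [hN]; push_cast; ring
    rw [← hN] at e₂
    rw [hN1'] at e₁
    rw [hN1', hN2']
    have hN0 : 1 ≤ N := by rw [hN]; linarith
    obtain ⟨hM0, hM⟩ := rowMain_bound ha hk L hLp N (by linarith) (fun i hi => by
      have : ((i + k : ℕ) : ℝ) ≤ p := by exact_mod_cast hL i hi
      push_cast at this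
      rw [hN]; linarith)
    rw [hLt] at hM
    generalize splitRatio α β a k I p m (ξ + 1) y = q₁ at *
    generalize splitRatio α β a k I p m ξ (y + 1) = q₂ at *
    generalize rowMain a k L (N + 1) = M₁ at *
    generalize rowMain a k L N = M₂ at *
    have hq₂ : |q₂| ≤ |q₂ - M₂| + M₂ := by
      have := abs_add_le (q₂ - M₂) M₂
      rwa [sub_add_cancel, abs_of_nonneg hM0] at this
    -- The second term needs only the order of `q₂`, namely N^(-t); its prefactor (y + 1)/N supplies
    -- the missing power.
    have hqN : |q₂| * N ^ t ≤ 2 ^ (t ^ 2) + K₂ := by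
      have h3 : |q₂ - M₂| * N ^ t ≤ K₂ := by
        refine le_trans ?_ e₂
        gcongr
        omega
      have h4 := mul_le_mul_of_nonneg_right hq₂ (pow_nonneg (zero_le_one.trans hN0) t)
      linarith
    have hsum : |q₁ + (y + 1) / N * q₂ - M₁| ≤ |q₁ - M₁| + (y + 1) / N * |q₂| := by
      have h5 := abs_add_le (q₁ - M₁) ((y + 1) / N * q₂)
      have h6 : (0 : ℝ) ≤ (y + 1) / N := by positivity
      rw [abs_mul, abs_of_nonneg h6] at h5
      rwa [show q₁ + (y + 1) / N * q₂ - M₁ = q₁ - M₁ + (y + 1) / N * q₂ by ring]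
    have hsec : (y + 1) / N * |q₂| * (N + 1) ^ (t + 1)
        ≤ (y + 1) * 2 ^ (t + 1) * (2 ^ (t ^ 2) + K₂) := by
      have h7 : (N + 1) ^ (t + 1) ≤ (2 * N) ^ (t + 1) := by gcongr; linarith
      calc _ ≤ (y + 1) / N * |q₂| * (2 * N) ^ (t + 1) := by gcongr
        _ = (y + 1) * 2 ^ (t + 1) * (|q₂| * N ^ t) := by
            have : N ≠ 0 := by linarith
            rw [mul_pow, pow_succ N]
            field_simp
        _ ≤ _ := by gcongr
    calc _ ≤ (|q₁ - M₁| + (y + 1) / N * |q₂|) * (N + 1) ^ (t + 1) := by gcongr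
      _ ≤ _ := by linarith

/-- The probability of well-spaced events is the main term up to a relative error
`O(1 / (a + ξ + n))`. -/
theorem ratio_estimate {k : ℕ} (hk : 2 ≤ k) (t : ℕ) :
    ∃ K, 0 ≤ K ∧ ∀ α β a : ℝ, 0 < a → α * a = 1 → 0 < β →
      ∀ (I : Finset ℕ) (L : List ℕ) (n : ℕ), L.length = t → L.Pairwise (fun i i' => i' + k ≤ i) →
      (∀ i < n, i ∈ I ↔ i ∈ L) → (∀ i ∈ L, i + k ≤ n) → ∀ ξ, 0 ≤ ξ →
        |ratio α β a k I n ξ - rowMain a k L (a + ξ + n)| * (a + ξ + n) ^ (t + 1) ≤ K := by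
  induction t with
  | zero =>
    refine ⟨0, le_rfl, fun α β a ha haα hβ I L n hLt _ hI _ => ?_⟩
    rw [List.length_eq_zero_iff] at hLt
    subst hLt
    have : ∀ ξ, 0 ≤ ξ → ratio α β a k I n ξ = 1 := by
      induction n with
      | zero => intro ξ _; exact ratio_zero ξ
      | succ n ih =>
        intro ξ hξ
        rw [ratio_plain ha haα hβ hk (fun i hi hin => absurd ((hI i (by omega)).1 hi) (by simp)) hξ]
        exact ih (fun i hi => hI i (by omega)) (by simp) (ξ + 1) (by linarith)
    intro ξ hξ
    simp [this ξ hξ, rowMain]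
  | succ t ih =>
    obtain ⟨K, hK, h⟩ := ih
    obtain ⟨K', hK', h'⟩ := splitRatio_estimate (t := t) hk hK (k - 2) 1
    refine ⟨(1 + 2 ^ ((t + 1) ^ 2)) * (k + 1) ^ (t + 2) + 9 * 3 ^ (t + 1) * K', by positivity,
      fun α β a ha haα hβ I L n hLt hLp hI hL => ?_⟩
    obtain ⟨p, L, rfl⟩ := List.exists_cons_of_length_eq_add_one hLt
    rw [List.length_cons, Nat.add_right_cancel_iff] at hLt
    have hLp' := List.pairwise_cons.1 hLp
    have hpn : p + k ≤ n := hL p (by simp)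
    induction n, hpn using Nat.le_induction with
    | base =>
      intro ξ hξ
      have hk' : (2 : ℝ) ≤ k := by exact_mod_cast hk
      have hp0 : (0 : ℝ) ≤ p := Nat.cast_nonneg p
      obtain ⟨N, hN⟩ : ∃ N, N = a + ξ + (p + k : ℕ) := ⟨_, rfl⟩
      have hN' : N = a + ξ + p + k := by rw [hN]; push_cast; ring
      have hM := rowMain_bound ha hk (p :: L) hLp N (by rw [hN']; positivity) (fun i hi => by
        have : ((i + k : ℕ) : ℝ) ≤ (p + k : ℕ) := by exact_mod_cast hL i hi
        rw [hN]; push_cast at this ⊢; linarith)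
      rw [List.length_cons, hLt] at hM
      have hN1 : 1 ≤ N := by rw [hN']; linarith
      rw [← hN]
      -- For bounded N the trivial bounds on the probability and the main term suffice. Otherwise a
      -- + ξ + p ≥ 1, as `splitRatio_estimate` requires, and N ≥ 3, so N ≤ 3(N - 2).
      by_cases hNk : N < k + 1
      · have h0 := ratio_nonneg (k := k) (I := I) (n := p + k) ha haα hβ hξ
        have h1 := ratio_le_one (I := I) (n := p + k) ha haα hβ hk hξ
        have hM1 : rowMain a k (p :: L) N ≤ 2 ^ ((t + 1) ^ 2) := by
          refine le_trans ?_ hM.2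
          exact le_mul_of_one_le_right hM.1 (one_le_pow₀ hN1)
        have habs : |ratio α β a k I (p + k) ξ - rowMain a k (p :: L) N|
            ≤ 1 + 2 ^ ((t + 1) ^ 2) := by
          rw [abs_le]; constructor <;> linarith [hM.1]
        calc _ ≤ (1 + 2 ^ ((t + 1) ^ 2)) * ((k : ℝ) + 1) ^ (t + 2) := by
              refine mul_le_mul habs ?_ (by positivity) (by positivity)
              exact pow_le_pow_left₀ (by linarith) hNk.le _
          _ ≤ _ := le_add_of_nonneg_right (by positivity)
      · rw [not_lt] at hNk
        have hLp1 : ∀ i ∈ L, i + k ≤ p := fun i hi => hLp'.1 i hi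
        have hest := h' α β a ha haα hβ I L p hLt hLp'.2 hLp1
          (fun i hi hik => by
            rcases List.mem_cons.1 ((hI i (by omega)).1 hi) with h1 | h1
            · omega
            · exact Or.inl (hLp1 i h1))
          (h α β a ha haα hβ I L p hLt hLp'.2 (fun i hi => by
            rw [hI i (by omega), List.mem_cons]
            exact ⟨fun h1 => h1.resolve_left (by omega), Or.inr⟩) hLp1) ξ hξ
            (by linarith)
        have hN2 : a + ξ + p + ((k - 2 : ℕ) : ℝ) = N - 2 := by
          rw [Nat.cast_sub hk, hN']; push_cast; ring
        rw [hN2] at hest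
        rw [ratio_event ha haα hβ hk ((hI p (by omega)).2 (by simp)) hξ, rowMain, ← hN,
          show N - a - k - p = ξ by rw [hN']; ring, ← mul_sub, abs_mul]
        have hd : 0 < (N - 1) * (N - 2) := mul_pos (by linarith) (by linarith)
        rw [abs_of_nonneg (div_nonneg hξ hd.le)]
        have hf : ξ / ((N - 1) * (N - 2)) * N ≤ 9 := by
          rw [div_mul_eq_mul_div, div_le_iff₀ hd]
          have : ξ ≤ N := by rw [hN']; linarith
          nlinarith
        have hp3 : N ^ (t + 1) ≤ 3 ^ (t + 1) * (N - 2) ^ (t + 1) := by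
          rw [← mul_pow]
          exact pow_le_pow_left₀ (by linarith) (by linarith) _
        have hE := abs_nonneg (splitRatio α β a k I p (k - 2) ξ 1 - rowMain a k L (N - 2))
        generalize |splitRatio α β a k I p (k - 2) ξ 1 - rowMain a k L (N - 2)| = E at *
        calc _ = (ξ / ((N - 1) * (N - 2)) * N) * (E * N ^ (t + 1)) := by rw [pow_succ _ (t + 1)]; ring
          _ ≤ 9 * (E * (3 ^ (t + 1) * (N - 2) ^ (t + 1))) :=
              mul_le_mul hf (by gcongr) (by positivity) (by norm_num)
          _ = 9 * 3 ^ (t + 1) * (E * (N - 2) ^ (t + 1)) := by ring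
          _ ≤ 9 * 3 ^ (t + 1) * K' := by gcongr
          _ ≤ _ := le_add_of_nonneg_left (by positivity)
    | succ n hn ihn =>
      intro ξ hξ
      have := ihn (fun i hi => hI i (by omega)) (fun i hi => by
        rcases List.mem_cons.1 hi with h1 | h1
        · omega
        · have := hLp'.1 i h1; omega) (ξ + 1) (by linarith)
      rw [ratio_plain ha haα hβ hk (fun i hi hin => ?_) hξ,
        show a + ξ + ((n + 1 : ℕ) : ℝ) = a + (ξ + 1) + n by push_cast; ring]
      · exact this
      · rcases List.mem_cons.1 ((hI i (by omega)).1 hi) with h1 | h1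
        · omega
        · have := hLp'.1 i h1; omega

/-! ### From rows back to columns -/

theorem rowMain_ofFn (a : ℝ) (k : ℕ) {r : ℕ} : ∀ (f : Fin r → ℕ) (N : ℝ),
    rowMain a k (List.ofFn f) N
      = ∏ l : Fin r, (N - 2 * l - a - k - f l) / ((N - 2 * l - 1) * (N - 2 * l - 2)) := by
  induction r with
  | zero => intro f N; simp [rowMain]
  | succ r ih =>
    intro f N
    rw [List.ofFn_succ, rowMain, ih, Fin.prod_univ_succ]
    congr 1
    · simp
    · refine Finset.prod_congr rfl fun l _ => ?_
      rw [Fin.val_succ]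
      push_cast
      ring_nf

theorem mainTerm_eq (n : ℕ) (a b : ℝ) {r : ℕ} (j : Fin r → ℕ) :
    mainTerm n a b j = ∏ l : Fin r, (b + j l - 2 * l - 1) /
      ((n + a + b - 2 * l - 1) * (n + a + b - 2 * l - 2)) := by
  unfold mainTerm
  rw [← Equiv.prod_comp Fin.revPerm]
  refine Finset.prod_congr rfl fun l _ => ?_
  have hl : ((l.rev : ℕ) : ℝ) = r - 1 - l := by
    rw [Fin.val_rev, Nat.cast_sub (by omega)]; push_cast; ring
  simp only [Fin.revPerm_apply, Fin.rev_rev, hl, descPochhammer_eval_eq_prod_range,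
    Finset.prod_range_succ, Finset.prod_range_zero]
  push_cast
  ring_nf

section Positions

variable {n k r : ℕ} {j : Fin r → ℕ}

/-- The row of the box in column `j l` of the `k`-th diagonal. -/
def eventRow (n k : ℕ) {r : ℕ} (j : Fin r → ℕ) (l : Fin r) : ℕ := n + 1 - k - j l

/-- Increasing columns on a diagonal are decreasing rows, so the list begins with the row whose
event is added last. -/
theorem mainTerm_eq_rowMain (hj : IsPositions n k j) (a b : ℝ) :
    mainTerm n a b j = rowMain a k (List.ofFn (eventRow n k j)) (a + b + n) := by
  rw [mainTerm_eq, rowMain_ofFn]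
  refine Finset.prod_congr rfl fun l _ => ?_
  have h := (hj.2 l).2
  have : (eventRow n k j l : ℝ) = n + 1 - k - j l := by
    rw [eventRow, Nat.cast_sub (by omega), Nat.cast_sub (by omega)]; push_cast; ring
  rw [this]
  ring_nf

theorem eventRow_injective (hj : IsPositions n k j) : Function.Injective (eventRow n k j) := by
  intro l l' h
  have h1 := (hj.2 l).2
  have h2 := (hj.2 l').2
  unfold eventRow at h
  exact hj.1.injective (by omega)

theorem eventRow_add_le (hj : IsPositions n k j) (l : Fin r) : eventRow n k j l + k ≤ n := by
  have := hj.2 l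
  unfold eventRow; omega

theorem pairwise_eventRow (hj : IsPositions n k j) (hs : Spaced k j) :
    (List.ofFn (eventRow n k j)).Pairwise (fun i i' => i' + k ≤ i) := by
  rw [List.pairwise_ofFn]
  intro l l' hll
  have h1 := hs l ⟨l + 1, by omega⟩ rfl
  have h2 : j ⟨l + 1, by omega⟩ ≤ j l' := hj.1.monotone (by rw [Fin.le_def]; exact hll)
  have h3 := hj.2 l
  have h4 := hj.2 l'
  unfold eventRow
  omega

theorem events_iff (hk : 2 ≤ k) (hj : IsPositions n k j) (T : Filling n) :
    Events k (Finset.univ.image (eventRow n k j)) T ↔ ∀ l, AlphaAt k (j l) T := by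
  constructor
  · intro h l
    have hl := hj.2 l
    refine ⟨⟨eventRow n k j l, by unfold eventRow; omega⟩, ⟨j l - 1, by omega⟩, by simp; omega,
      by simp [eventRow]; omega, h _ _ (by simp) (by simp [eventRow]; omega)⟩
  · intro h i c hi hic
    simp only [Finset.mem_image, Finset.mem_univ, true_and] at hi
    obtain ⟨l, hl⟩ := hi
    obtain ⟨i', c', h1, h2, h3⟩ := h l
    have hl' := hj.2 l
    unfold eventRow at hl
    have hi' : i = i' := Fin.ext (by omega)
    have hc' : c = c' := Fin.ext (by omega)
    rw [hi', hc']; exact h3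

variable {α β : ℝ}

theorem Z_eq (α β : ℝ) (k n : ℕ) :
    Z n α β = genFun α β k ∅ n (fun _ => 1) (fun _ => 1) := by
  classical
  unfold Z genFun
  rw [Finset.filter_true_of_mem (fun T _ r c hr => by simp at hr)]
  refine Finset.sum_congr rfl fun T _ => ?_
  simp [rowMark]

theorem Z_eq_totalWeight (hα : 0 < α) (hβ : 0 < β) (n : ℕ) :
    Z n α β = totalWeight α β n (α⁻¹ + β⁻¹) := by
  rw [Z_eq α β 2, ← genFun_empty (k := 2) (mul_inv_cancel₀ hα.ne') le_rfl, mul_inv_cancel₀ hβ.ne']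

theorem alphaProb_eq (hk : 2 ≤ k) (hj : IsPositions n k j) (hα : 0 < α) (hβ : 0 < β) :
    alphaProb n k α β j
      = ratio α β α⁻¹ k (Finset.univ.image (eventRow n k j)) n β⁻¹ := by
  classical
  unfold alphaProb prob ratio
  rw [← Finset.sum_div, Z_eq_totalWeight hα hβ, mul_inv_cancel₀ hβ.ne']
  congr 1
  unfold genFun
  refine Finset.sum_congr (Finset.ext fun T => ?_) fun T _ => ?_
  · simp only [Finset.mem_filter, events_iff hk hj]
  · simp [rowMark]

/-- At size `n` all events have taken place: no row is waiting, the power of β in `aliveGen_le` is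
trivial, and every row of `I` has been born. -/
theorem alphaProb_mul_pow_le (hk : 2 ≤ k) (hj : IsPositions n k j) (hα : 0 < α) (hβ : 0 < β) :
    alphaProb n k α β j * (n + α⁻¹ + β⁻¹) ^ r ≤ (2 ^ r) ^ (k * r) := by
  set I := Finset.univ.image (eventRow n k j)
  have hI : ∀ i ∈ I, i + k ≤ n := by
    intro i hi
    simp only [I, Finset.mem_image, Finset.mem_univ, true_and] at hi
    obtain ⟨l, rfl⟩ := hi
    exact eventRow_add_le hj l
  have hcard : I.card = r := by
    rw [Finset.card_image_of_injective _ (eventRow_injective hj)]; simp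
  have hnot : ∀ i, ¬ Alive k I n i := fun i h => by
    have := hI i h.1
    have := h.2.2
    omega
  have hcount : aliveCount k I n = 0 := by
    classical
    rw [aliveCount, Finset.card_eq_zero, Finset.filter_eq_empty_iff]
    exact fun i _ => hnot i
  have hborn : bornCount I n = r := by
    rw [← hcard, bornCount]
    congr 1
    ext i
    simp only [Finset.mem_filter, Finset.mem_range]
    exact ⟨fun h => h.2, fun h => ⟨by have := hI i h; omega, h⟩⟩
  have ha : 0 < α⁻¹ := inv_pos.2 hα
  have hb : 0 < β⁻¹ := inv_pos.2 hβ
  have h := aliveGen_le (I := I) ha (mul_inv_cancel₀ hα.ne') hβ hk n β⁻¹ hb.le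
    (fun h => by omega)
  have hD := totalWeight_pos (n := n) hα hβ (add_pos ha hb)
  have hgen : aliveGen α β k I n (β * β⁻¹)
      = genFun α β k I n (fun _ => β * β⁻¹) (fun _ => 1) :=
    genFun_congr (fun i _ => if_neg (hnot i)) (fun i _ => if_neg (hnot i))
  rw [hcount, hborn, hcard, pow_zero, mul_one, hgen] at h
  rw [alphaProb_eq hk hj hα hβ, ratio, div_mul_eq_mul_div, div_le_iff₀ hD,
    show (n : ℝ) + α⁻¹ + β⁻¹ = α⁻¹ + β⁻¹ + n by ring]
  refine h.trans (mul_le_mul_of_nonneg_right ?_ hD.le)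
  refine pow_le_pow_right₀ (one_le_pow₀ (by norm_num)) ?_
  rw [← hcard]
  exact sum_aliveCount_le

theorem alphaProb_nonneg (hk : 2 ≤ k) (hj : IsPositions n k j) (hα : 0 < α) (hβ : 0 < β) :
    0 ≤ alphaProb n k α β j := by
  rw [alphaProb_eq hk hj hα hβ]
  exact ratio_nonneg (inv_pos.2 hα) (mul_inv_cancel₀ hα.ne') hβ (inv_pos.2 hβ).le

theorem alphaProb_le_one (hk : 2 ≤ k) (hj : IsPositions n k j) (hα : 0 < α) (hβ : 0 < β) :
    alphaProb n k α β j ≤ 1 := by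
  rw [alphaProb_eq hk hj hα hβ]
  exact ratio_le_one (inv_pos.2 hα) (mul_inv_cancel₀ hα.ne') hβ hk (inv_pos.2 hβ).le

theorem abs_mainTerm_le (hk : 2 ≤ k) (hr : 1 ≤ r) (hj : IsPositions n k j) (hs : Spaced k j)
    {a b : ℝ} (ha : 0 < a) (hb : 0 < b) : |mainTerm n a b j| ≤ 2 ^ (r ^ 2) := by
  have hn : (1 : ℝ) ≤ n := by
    have := hj.2 ⟨0, hr⟩
    exact_mod_cast (by omega : 1 ≤ n)
  have hN : 1 ≤ a + b + n := by linarith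
  have h := rowMain_bound ha hk _ (pairwise_eventRow hj hs) (a + b + n) (by linarith)
    (fun i hi => by
      rw [List.mem_ofFn] at hi
      obtain ⟨l, rfl⟩ := hi
      have : ((eventRow n k j l + k : ℕ) : ℝ) ≤ n := by exact_mod_cast eventRow_add_le hj l
      push_cast at this; linarith)
  rw [List.length_ofFn] at h
  rw [mainTerm_eq_rowMain hj, abs_of_nonneg h.1]
  exact (le_mul_of_one_le_right h.1 (one_le_pow₀ hN)).trans h.2

/-- The estimates for positive parameters. -/
theorem alphaProb_estimate (hk : 2 ≤ k) (r : ℕ) :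
    ∃ C : ℝ, ∀ (n : ℕ) (j : Fin r → ℕ), IsPositions n k j → ∀ α β : ℝ, 0 < α → 0 < β →
      (Spaced k j → |alphaProb n k α β j - mainTerm n α⁻¹ β⁻¹ j|
        ≤ C / ((n : ℝ) + α⁻¹ + β⁻¹) ^ (r + 1)) ∧
      |alphaProb n k α β j| ≤ C / ((n : ℝ) + α⁻¹ + β⁻¹) ^ r := by
  obtain ⟨K, hK, h⟩ := ratio_estimate hk r
  refine ⟨max K ((2 ^ r) ^ (k * r)), fun n j hj α β hα hβ => ?_⟩
  have ha : 0 < α⁻¹ := inv_pos.2 hα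
  have hb : 0 < β⁻¹ := inv_pos.2 hβ
  have hN : 0 < (n : ℝ) + α⁻¹ + β⁻¹ := by positivity
  refine ⟨fun hs => ?_, ?_⟩
  · rw [le_div_iff₀ (by positivity), alphaProb_eq hk hj hα hβ, mainTerm_eq_rowMain hj,
      show (n : ℝ) + α⁻¹ + β⁻¹ = α⁻¹ + β⁻¹ + n by ring]
    refine (h α β α⁻¹ ha (mul_inv_cancel₀ hα.ne') hβ _ (List.ofFn (eventRow n k j)) n
      (List.length_ofFn) (pairwise_eventRow hj hs) (fun i _ => ?_) (fun i hi => ?_) β⁻¹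
      hb.le).trans (le_max_left _ _)
    · simp [List.mem_ofFn]
    · rw [List.mem_ofFn] at hi
      obtain ⟨l, rfl⟩ := hi
      exact eventRow_add_le hj l
  · rw [abs_of_nonneg (alphaProb_nonneg hk hj hα hβ), le_div_iff₀ (by positivity)]
    exact (alphaProb_mul_pow_le hk hj hα hβ).trans (le_max_right _ _)

/-! ### One parameter equal to zero -/

theorem weight_eq_zero_of_alpha {T : Filling n} {i c : Fin n} (h : T i c = some Symb.alpha) :
    weight 0 β T = 0 :=
  Finset.prod_eq_zero (Finset.mem_univ i)
    (Finset.prod_eq_zero (Finset.mem_univ c) (by rw [h, boxWeight]))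

theorem weight_eq_zero_of_beta {T : Filling n} {i c : Fin n} (h : T i c = some Symb.beta) :
    weight α 0 T = 0 :=
  Finset.prod_eq_zero (Finset.mem_univ i)
    (Finset.prod_eq_zero (Finset.mem_univ c) (by rw [h, boxWeight]))

theorem alphaProb_zero_left (hr : 1 ≤ r) (j : Fin r → ℕ) : alphaProb n k 0 β j = 0 := by
  classical
  refine Finset.sum_eq_zero fun T hT => ?_
  simp only [Finset.mem_filter] at hT
  obtain ⟨i, c, _, _, h⟩ := hT.2 ⟨0, hr⟩
  rw [weight_eq_zero_of_alpha h, zero_div]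

theorem alphaProb_zero_right (hk : 2 ≤ k) (hr : 1 ≤ r) (j : Fin r → ℕ) :
    alphaProb n k α 0 j = 0 := by
  classical
  refine Finset.sum_eq_zero fun T hT => ?_
  simp only [tableaux, Finset.mem_filter, Finset.mem_univ, true_and] at hT
  obtain ⟨hS, hT⟩ := hT
  obtain ⟨i, c, _, hic, h⟩ := hT ⟨0, hr⟩
  -- As k ≥ 2, the box of this column on the first diagonal lies strictly south of the event's α. It
  -- is filled, and it cannot hold an α, so it holds a β.
  have hd : T ⟨n - 1 - c, by omega⟩ c ≠ none := hS.diagonal _ _ (by simp; omega)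
  have hne : T ⟨n - 1 - c, by omega⟩ c ≠ some Symb.alpha := fun h' => by
    have := hS.north _ c h' i (by rw [Fin.lt_def]; simp; omega)
    rw [this] at h; cases h
  have hb : T ⟨n - 1 - c, by omega⟩ c = some Symb.beta := by
    rcases h' : T ⟨n - 1 - c, by omega⟩ c with _ | _ | _
    · exact absurd h' hd
    · exact absurd h' hne
    · rfl
  rw [weight_eq_zero_of_beta hb, zero_div]

end Positions

/-! ### Infinite parameters -/

section EventuallyRational

/-- The function agrees with a rational function near `∞`. -/
def EventuallyRational (f : ℝ → ℝ) : Prop :=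
  ∃ P Q : Polynomial ℝ, Q ≠ 0 ∧ ∀ᶠ t in atTop, f t = P.eval t / Q.eval t

namespace EventuallyRational

variable {f g : ℝ → ℝ}

theorem const (c : ℝ) : EventuallyRational fun _ => c :=
  ⟨Polynomial.C c, 1, one_ne_zero, by simp⟩

theorem id : EventuallyRational fun t => t :=
  ⟨Polynomial.X, 1, one_ne_zero, by simp⟩

theorem add (hf : EventuallyRational f) (hg : EventuallyRational g) :
    EventuallyRational fun t => f t + g t := by
  obtain ⟨P, Q, hQ, hf⟩ := hf
  obtain ⟨P', Q', hQ', hg⟩ := hg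
  refine ⟨P * Q' + Q * P', Q * Q', mul_ne_zero hQ hQ', ?_⟩
  filter_upwards [hf, hg, Polynomial.eventually_atTop_not_isRoot Q hQ,
    Polynomial.eventually_atTop_not_isRoot Q' hQ'] with t h1 h2 h3 h4
  rw [h1, h2, div_add_div _ _ h3 h4]
  simp

theorem mul (hf : EventuallyRational f) (hg : EventuallyRational g) :
    EventuallyRational fun t => f t * g t := by
  obtain ⟨P, Q, hQ, hf⟩ := hf
  obtain ⟨P', Q', hQ', hg⟩ := hg
  refine ⟨P * P', Q * Q', mul_ne_zero hQ hQ', ?_⟩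
  filter_upwards [hf, hg] with t h1 h2
  rw [h1, h2, div_mul_div_comm]
  simp

theorem inv (hf : EventuallyRational f) : EventuallyRational fun t => (f t)⁻¹ := by
  obtain ⟨P, Q, hQ, hf⟩ := hf
  by_cases hP : P = 0
  · refine ⟨0, 1, one_ne_zero, ?_⟩
    filter_upwards [hf] with t h1
    simp [h1, hP]
  · refine ⟨Q, P, hP, ?_⟩
    filter_upwards [hf] with t h1
    rw [h1, inv_div]

theorem div (hf : EventuallyRational f) (hg : EventuallyRational g) :
    EventuallyRational fun t => f t / g t := by
  simpa only [div_eq_mul_inv] using hf.mul hg.inv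

theorem sub_const (hf : EventuallyRational f) (c : ℝ) : EventuallyRational fun t => f t - c := by
  simpa only [sub_eq_add_neg] using hf.add (const (-c))

theorem sum {ι : Type*} (s : Finset ι) {f : ι → ℝ → ℝ} (h : ∀ i ∈ s, EventuallyRational (f i)) :
    EventuallyRational fun t => ∑ i ∈ s, f i t := by
  classical
  induction s using Finset.induction_on with
  | empty => simpa using const 0
  | insert i s hi ih =>
    simp only [Finset.sum_insert hi]
    exact (h i (by simp)).add (ih fun i' hi' => h i' (by simp [hi']))

theorem prod {ι : Type*} (s : Finset ι) {f : ι → ℝ → ℝ} (h : ∀ i ∈ s, EventuallyRational (f i)) :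
    EventuallyRational fun t => ∏ i ∈ s, f i t := by
  classical
  induction s using Finset.induction_on with
  | empty => simpa using const 1
  | insert i s hi ih =>
    simp only [Finset.prod_insert hi]
    exact (h i (by simp)).mul (ih fun i' hi' => h i' (by simp [hi']))

/-- Boundedness excludes a numerator of larger degree than the denominator, and in the other cases
the quotient converges. -/
theorem exists_tendsto (hf : EventuallyRational f) {B : ℝ} (hB : ∀ᶠ t in atTop, |f t| ≤ B) :
    ∃ p, Tendsto f atTop (𝓝 p) := by
  obtain ⟨P, Q, hQ, hf⟩ := hf
  have hc : (fun t => P.eval t / Q.eval t) =ᶠ[atTop] f := hf.mono fun t h => h.symm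
  rcases lt_trichotomy P.degree Q.degree with h | h | h
  · exact ⟨0, (P.div_tendsto_atTop_zero_of_degree_lt Q h).congr' hc⟩
  · exact ⟨_, (P.div_tendsto_atTop_leadingCoeff_div_of_degree_eq Q h).congr' hc⟩
  · exfalso
    have h1 := P.abs_div_tendsto_atTop_atTop_of_degree_gt Q h hQ
    obtain ⟨t, h2, h3, h4⟩ := (hB.and (hf.and (h1.eventually_gt_atTop B))).exists
    rw [h3] at h2
    linarith

variable {x y : ℝ → ℝ}

theorem weight (hx : EventuallyRational x) (hy : EventuallyRational y) {n : ℕ} (T : Filling n) :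
    EventuallyRational fun t => weight (x t) (y t) T := by
  refine prod _ fun i _ => prod _ fun c _ => ?_
  rcases T i c with _ | _ | _
  · exact const 1
  · exact hx
  · exact hy

theorem alphaProb (hx : EventuallyRational x) (hy : EventuallyRational y) (n k : ℕ) {r : ℕ}
    (j : Fin r → ℕ) : EventuallyRational fun t => alphaProb n k (x t) (y t) j :=
  sum _ fun T _ => (hx.weight hy T).div (sum _ fun T _ => hx.weight hy T)

theorem mainTerm (hx : EventuallyRational x) (hy : EventuallyRational y) (n : ℕ) {r : ℕ}
    (j : Fin r → ℕ) : EventuallyRational fun t => mainTerm n (x t) (y t) j := by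
  simp only [mainTerm_eq]
  refine prod _ fun l _ => ?_
  have h := (((const (n : ℝ)).add hx).add hy).sub_const (2 * l)
  exact (((hy.add (const _)).sub_const _).sub_const _).div ((h.sub_const 1).mul (h.sub_const 2))

end EventuallyRational

end EventuallyRational

/-- Both sides of each estimate converge; since n ≥ 1, the limit n + a + b of the denominators' base
is positive even when a = b = 0. -/
theorem limitEstimate_of_estimate {n k r : ℕ} (hk : 2 ≤ k) (hr : 1 ≤ r) {j : Fin r → ℕ}
    (hj : IsPositions n k j) {C : ℝ}
    (h : ∀ α β : ℝ, 0 < α → 0 < β →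
      (Spaced k j → |alphaProb n k α β j - mainTerm n α⁻¹ β⁻¹ j|
        ≤ C / ((n : ℝ) + α⁻¹ + β⁻¹) ^ (r + 1)) ∧
      |alphaProb n k α β j| ≤ C / ((n : ℝ) + α⁻¹ + β⁻¹) ^ r)
    {x y : ℝ → ℝ} {a b : ℝ} (hx : EventuallyRational x) (hy : EventuallyRational y)
    (hx0 : ∀ᶠ t in atTop, 0 < x t) (hy0 : ∀ᶠ t in atTop, 0 < y t)
    (hxa : Tendsto (fun t => (x t)⁻¹) atTop (𝓝 a)) (hyb : Tendsto (fun t => (y t)⁻¹) atTop (𝓝 b)) :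
    LimitEstimate C n k j x y a b := by
  have hpos := hx0.and hy0
  have ha : 0 ≤ a := ge_of_tendsto hxa (hx0.mono fun t h => (inv_pos.2 h).le)
  have hb : 0 ≤ b := ge_of_tendsto hyb (hy0.mono fun t h => (inv_pos.2 h).le)
  have hn : (0 : ℝ) < n := by
    have := hj.2 ⟨0, hr⟩
    exact_mod_cast (by omega : 0 < n)
  have hN : Tendsto (fun t => (n : ℝ) + (x t)⁻¹ + (y t)⁻¹) atTop (𝓝 (n + a + b)) :=
    (tendsto_const_nhds.add hxa).add hyb
  have hbound : ∀ m : ℕ, Tendsto (fun t => C / ((n : ℝ) + (x t)⁻¹ + (y t)⁻¹) ^ m) atTop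
      (𝓝 (C / (n + a + b) ^ m)) := fun m =>
    tendsto_const_nhds.div (hN.pow m) (by positivity)
  obtain ⟨p, hp⟩ := (hx.alphaProb hy n k j).exists_tendsto (B := 1) (hpos.mono fun t ht => by
    rw [abs_of_nonneg (alphaProb_nonneg hk hj ht.1 ht.2)]
    exact alphaProb_le_one hk hj ht.1 ht.2)
  refine ⟨p, hp, fun hs => ?_, fun _ => ?_⟩
  · obtain ⟨M, hM⟩ := (hx.inv.mainTerm hy.inv n j).exists_tendsto (hpos.mono fun t ht =>
      abs_mainTerm_le hk hr hj hs (inv_pos.2 ht.1) (inv_pos.2 ht.2))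
    exact ⟨M, hM, le_of_tendsto_of_tendsto (hp.sub hM).abs (hbound (r + 1))
      (hpos.mono fun t ht => (h _ _ ht.1 ht.2).1 hs)⟩
  · exact le_of_tendsto_of_tendsto hp.abs (hbound r) (hpos.mono fun t ht => (h _ _ ht.1 ht.2).2)

end StaircaseTableau

open StaircaseTableau
theorem theorem4p1 (k r : ℕ) (hk : 2 ≤ k) (hr : 1 ≤ r) :
    ∃ C : ℝ, ∀ (n : ℕ) (j : Fin r → ℕ), IsPositions n k j →
      -- finite nonzero parameters
      (∀ α β : ℝ, 0 < α → 0 < β →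
        (Spaced k j →
          |alphaProb n k α β j - mainTerm n α⁻¹ β⁻¹ j|
            ≤ C / ((n : ℝ) + α⁻¹ + β⁻¹) ^ (r + 1)) ∧
        (¬ Spaced k j →
          |alphaProb n k α β j| ≤ C / ((n : ℝ) + α⁻¹ + β⁻¹) ^ r)) ∧
      -- one parameter equal to zero, where `1 / (n + a + b)` is read as `0`
      (∀ β : ℝ, 0 < β → alphaProb n k 0 β j = 0) ∧
      (∀ α : ℝ, 0 < α → alphaProb n k α 0 j = 0) ∧
      -- infinite parameters, as limits
      (∀ β : ℝ, 0 < β → LimitEstimate C n k j (fun t => t) (fun _ => β) 0 β⁻¹) ∧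
      (∀ α : ℝ, 0 < α → LimitEstimate C n k j (fun _ => α) (fun t => t) α⁻¹ 0) ∧
      LimitEstimate C n k j (fun t => t) (fun t => t) 0 0 := by
  obtain ⟨C, hC⟩ := alphaProb_estimate hk r
  refine ⟨C, fun n j hj => ⟨fun α β hα hβ => ⟨(hC n j hj α β hα hβ).1,
    fun _ => (hC n j hj α β hα hβ).2⟩, fun β _ => alphaProb_zero_left hr j,
    fun α _ => alphaProb_zero_right hk hr j, fun β hβ => ?_, fun α hα => ?_, ?_⟩⟩
  · exact limitEstimate_of_estimate hk hr hj (hC n j hj) .id (.const β) (eventually_gt_atTop 0)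
      (Eventually.of_forall fun _ => hβ) tendsto_inv_atTop_zero tendsto_const_nhds
  · exact limitEstimate_of_estimate hk hr hj (hC n j hj) (.const α) .id
      (Eventually.of_forall fun _ => hα) (eventually_gt_atTop 0) tendsto_const_nhds
      tendsto_inv_atTop_zero
  · exact limitEstimate_of_estimate hk hr hj (hC n j hj) .id .id (eventually_gt_atTop 0)
      (eventually_gt_atTop 0) tendsto_inv_atTop_zero tendsto_inv_atTop_zero
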